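/- **Setting.** Let $\mathbb D$ be the open unit disk. A one-parameter semigroup is a family $(\phi_t)_{t\ge 0}$ of holomorphic self-maps of $\mathbb D$ with $\phi_0=\mathrm{id}$, $\phi_{s+t}=\phi_s\circ\phi_t$ and $\phi_t(z)\to z$ as $t\to0^+$ for every $z\in\mathbb D$; its infinitesimal generator is the holomorphic function $G$ on $\mathbb D$ with $\frac{d}{dt}\phi_t(z)=G(\phi_t(z))$ for all $z\in\mathbb D$, $t\ge0$. A point $\sigma\in\partial\mathbb D$ is a boundary regular fixed point of $(\phi_t)$ if for every $t\ge0$ the angular limit of $\phi_t$ at $\sigma$ equals $\sigma$ and the angular derivative $\phi_t'(\sigma)$ exists finitely; the spectral value at $\sigma$ is then the angular limit of $G(z)/(\sigma-z)$ as $z\to\sigma$ (a real number). Let $n\ge1$, let $\sigma_1,\dots,\sigma_n\in\partial\mathbb D$ be pairwise distinct, $F=\{\sigma_1,\dots,\sigma_n\}$, and let $\Lambda=(\lambda_1,\dots,\lambda_n)\in(-\infty,0)^n$. Let $\mathrm{Gen}_0(F,\Lambda)$ be the class of infinitesimal generators $G$ of one-parameter semigroups $(\phi_t)$ such that $0$ is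 the Denjoy–Wolff point of every $\phi_t\ne\mathrm{id}$ (so $G\equiv0$ is included) and every $\sigma_k$ is a boundary regular fixed point of $(\phi_t)$ with spectral value $\lambda_k'\in[\lambda_k,0]$. Let $\mathrm{Gen}_0'(F,\Lambda)$ be the subclass in which $\lambda'_k=\lambda_k$ for all $k$. For $G\in\mathrm{Gen}_0(F,\Lambda)$ let $\lambda(G)$ be its spectral value at $0$, i.e. the unique $\lambda\in\mathbb C$ with $\phi_t'(0)=e^{-\lambda t}$ for all $t\ge0$. Put $$r=\Big(\sum_{k=1}^n\frac1{|\lambda_k|}\Big)^{-1},\qquad \Omega=\{\omega\in\mathbb C:|\omega-r|\le r\},\qquad p_0(z)=\sum_{k=1}^n\frac{1}{2|\lambda_k|}\,\frac{\sigma_k+z}{\sigma_k-z},$$ $$\hat\ell_\omega=\frac1\omega-\frac12\sum_{k=1}^n\frac1{|\lambda_k|}\quad(\omega\ne0),$$ $$Z_\omega=\Big\{\zeta\in\mathbb C:\Big|\frac{\zeta}{2\omega^2}-\sum_{k=1}^n\frac{\overline{\sigma_k}}{|\lambda_k|}\Big|\le 2\,\mathrm{Re}\,\frac1\omega-\sum_{k=1}^n\frac1{|\lambda_k|}\Big\}\quad(\omega\in\Omega\setminus\{0\}),\qquad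 Z_0=\{0\}.$$ **Theorem.** 1. The spectral value $\lambda(G)$ is well defined for every $G\in\mathrm{Gen}_0(F,\Lambda)$, and the value region $$\widehat V(F,\Lambda)=\{(G''(0),\lambda(G)):G\in\mathrm{Gen}_0(F,\Lambda)\}\subset\mathbb C^2$$ is equal to $\{(\zeta,\omega)\in\mathbb C^2:\omega\in\Omega,\ \zeta\in Z_\omega\}$. 2. For each boundary point $(\zeta,\omega)$ of $\widehat V(F,\Lambda)$ there is exactly one $G\in\mathrm{Gen}_0(F,\Lambda)$ with $(G''(0),\lambda(G))=(\zeta,\omega)$. It has the form $$\widehat G_{\omega,\sigma}(z)=-\frac{z}{\frac{\sigma+z}{\sigma-z}\,\mathrm{Re}\,\hat\ell_\omega+i\,\mathrm{Im}\,\hat\ell_\omega+p_0(z)}\quad\text{for some }\sigma\in\partial\mathbb D,\ \text{ if }\omega\in\mathrm{int}\,\Omega,$$ $$\widehat G_\omega(z)=-\frac{z}{i\,\mathrm{Im}\,\hat\ell_\omega+p_0(z)}\quad\text{if }\omega\in\partial\Omega\setminus\{0\},\qquad\text{and}\qquad \widehat G_0\equiv0\quad\text{if }\omega=0.$$ Conversely,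 all these functions ($\omega\in\mathrm{int}\,\Omega$, $\sigma\in\partial\mathbb D$; $\omega\in\partial\Omega\setminus\{0\}$; $\omega=0$) belong to $\mathrm{Gen}_0(F,\Lambda)$, have $\lambda(G)=\omega$, and deliver boundary points of $\widehat V(F,\Lambda)$. 3. For every $G\in\mathrm{Gen}_0(F,\Lambda)$, $G\not\equiv0$, one has $\lambda(G)\neq0$ and, with $\lambda=\lambda(G)$, $$\Big|\frac{G''(0)}{2\lambda^2}-\sum_{k=1}^n\frac{\overline{\sigma_k}}{|\lambda_k|}\Big|\le 2\,\mathrm{Re}\,\frac1\lambda-\sum_{k=1}^n\frac1{|\lambda_k|}.$$ This is sharp: for every $\omega\in\Omega\setminus\{0\}$ there is $G\in\mathrm{Gen}'_0(F,\Lambda)$ with $\lambda(G)=\omega$ for which equality holds. -/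

import Mathlib

open Set Filter Topology ComplexConjugate

namespace DiskSemigroup

noncomputable section

/-- The open unit disk of the complex plane. Functions on the disk are represented by functions
`ℂ → ℂ`, of which only the values on `disk` matter. -/
abbrev disk : Set ℂ := Metric.ball 0 1

/-- The Stolz region with vertex `σ` and opening `M` (empty for `M ≤ 1` if `‖σ‖ = 1`). -/
def stolz (σ : ℂ) (M : ℝ) : Set ℂ := {z | z ∈ disk ∧ ‖σ - z‖ < M * (1 - ‖z‖)}

/-- The function `f` has the finite angular (non-tangential) limit `l` at `σ ∈ ∂𝔻`. -/
def HasAngularLimit (f : ℂ → ℂ) (σ l : ℂ) : Prop :=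
  ∀ M : ℝ, Tendsto f (𝓝[stolz σ M] σ) (𝓝 l)

/-- The boundary fixed point `σ` of `f` has the finite angular derivative `d`. -/
def HasAngularDeriv (f : ℂ → ℂ) (σ d : ℂ) : Prop :=
  HasAngularLimit (fun z => (f z - σ) / (z - σ)) σ d

/-- `σ ∈ ∂𝔻` is a boundary regular fixed point (BRFP) of `f`. -/
def IsBRFP (f : ℂ → ℂ) (σ : ℂ) : Prop :=
  ‖σ‖ = 1 ∧ HasAngularLimit f σ σ ∧ ∃ d : ℂ, HasAngularDeriv f σ d

/-- `τ` is the Denjoy-Wolff point of the holomorphic self-map `f ≠ id` of the disk: either the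
fixed point of `f` in the disk, or, if `f` has no fixed points in the disk, the boundary regular
fixed point at which the angular derivative is at most one. -/
def IsDWPoint (f : ℂ → ℂ) (τ : ℂ) : Prop :=
  ¬ EqOn f id disk ∧
    ((τ ∈ disk ∧ f τ = τ) ∨
      ((∀ z ∈ disk, f z ≠ z) ∧ IsBRFP f τ ∧ ∃ d : ℝ, d ≤ 1 ∧ HasAngularDeriv f τ (d : ℂ)))

/-- `(φ t)`, `t ≥ 0`, is a one-parameter semigroup of holomorphic self-maps of the disk. -/
structure IsSemigroup (φ : ℝ → ℂ → ℂ) : Prop where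
  differentiableOn : ∀ t, 0 ≤ t → DifferentiableOn ℂ (φ t) disk
  mapsTo : ∀ t, 0 ≤ t → MapsTo (φ t) disk disk
  zero : ∀ z ∈ disk, φ 0 z = z
  add : ∀ s t, 0 ≤ s → 0 ≤ t → ∀ z ∈ disk, φ (s + t) z = φ s (φ t z)
  tendsto : ∀ z ∈ disk, Tendsto (fun t => φ t z) (𝓝[>] 0) (𝓝 z)

/-- `G` is the infinitesimal generator of the one-parameter semigroup `φ`. -/
structure IsGenerator (G : ℂ → ℂ) (φ : ℝ → ℂ → ℂ) : Prop where
  isSemigroup : IsSemigroup φ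
  differentiableOn : DifferentiableOn ℂ G disk
  hasDeriv : ∀ z ∈ disk, ∀ t, 0 ≤ t →
    HasDerivWithinAt (fun s => φ s z) (G (φ t z)) (Ici 0) t

/-- `τ` is the Denjoy-Wolff point of `φ`, shared by all `φ t ≠ id`; by convention every `τ` is
admitted for the trivial semigroup. -/
def SemigroupDWPoint (φ : ℝ → ℂ → ℂ) (τ : ℂ) : Prop :=
  ∀ t, 0 ≤ t → ¬ EqOn (φ t) id disk → IsDWPoint (φ t) τ

/-- `σ` is a boundary regular fixed point of the semigroup `φ`. -/
def SemigroupBRFP (φ : ℝ → ℂ → ℂ) (σ : ℂ) : Prop := ∀ t, 0 ≤ t → IsBRFP (φ t) σ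

/-- The spectral value at a boundary regular fixed point `σ` of the semigroup generated by `G`
is `μ`, the angular limit of `G z / (σ - z)` at `σ`. -/
def HasBoundarySpectralValue (G : ℂ → ℂ) (σ : ℂ) (μ : ℝ) : Prop :=
  HasAngularLimit (fun z => G z / (σ - z)) σ (μ : ℂ)

/-- The class of generators of semigroups with Denjoy-Wolff point `τ` (including `G = 0`) that have
the boundary regular fixed points `σ k` with spectral values in the intervals `[Λ k, 0]`. -/
def Gen (τ : ℂ) {n : ℕ} (σ : Fin n → ℂ) (Λ : Fin n → ℝ) : Set (ℂ → ℂ) :=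
  {G | ∃ φ, IsGenerator G φ ∧ SemigroupDWPoint φ τ ∧
    ∀ k, SemigroupBRFP φ (σ k) ∧
      ∃ μ : ℝ, Λ k ≤ μ ∧ μ ≤ 0 ∧ HasBoundarySpectralValue G (σ k) μ}

/-- The subclass of `Gen τ σ Λ` in which the spectral values at `σ k` are exactly `Λ k`. -/
def GenExact (τ : ℂ) {n : ℕ} (σ : Fin n → ℂ) (Λ : Fin n → ℝ) : Set (ℂ → ℂ) :=
  {G | ∃ φ, IsGenerator G φ ∧ SemigroupDWPoint φ τ ∧
    ∀ k, SemigroupBRFP φ (σ k) ∧ HasBoundarySpectralValue G (σ k) (Λ k)}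

/-- `l` is the spectral value at the interior Denjoy-Wolff point `τ ∈ 𝔻` of the semigroup `φ`
generated by `G`, that is, `φ_t'(τ) = exp (-l t)` for all `t ≥ 0`. -/
def IsSpectralValue (G : ℂ → ℂ) (τ l : ℂ) : Prop :=
  ∃ φ, IsGenerator G φ ∧
    ∀ t : ℝ, 0 ≤ t → HasDerivAt (φ t) (Complex.exp (-(l * t))) τ

/-- The spectral value of the semigroup generated by `G` at its Denjoy-Wolff point `τ ∈ 𝔻`. -/
def spectralValue (G : ℂ → ℂ) (τ : ℂ) : ℂ := Classical.epsilon (IsSpectralValue G τ)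

/-- The pair `(G''(0), λ(G))` for a generator `G` with Denjoy-Wolff point `0`. -/
def valuePair (G : ℂ → ℂ) : ℂ × ℂ := (iteratedDeriv 2 G 0, spectralValue G 0)

/-- The sum of the numbers `1 / |λ_k|`. -/
def invSum {n : ℕ} (Λ : Fin n → ℝ) : ℝ := ∑ k, |Λ k|⁻¹

/-- The function `p₀ = ∑ α_k (σ_k + z) / (σ_k - z)` with `α_k = |τ - σ_k|² / (2 |λ_k|)`. -/
def pZero (τ : ℂ) {n : ℕ} (σ : Fin n → ℂ) (Λ : Fin n → ℝ) (z : ℂ) : ℂ :=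
  ∑ k, ((‖τ - σ k‖ ^ 2 / (2 * |Λ k|) : ℝ) : ℂ) * ((σ k + z) / (σ k - z))

/-- The closed disk `Ω` of centre and radius `r = (∑ 1 / |λ_k|)⁻¹`. -/
def Omega {n : ℕ} (Λ : Fin n → ℝ) : Set ℂ :=
  {ω | ‖ω - (((invSum Λ)⁻¹ : ℝ) : ℂ)‖ ≤ (invSum Λ)⁻¹}

/-- The closed disk `Z_ω`, with `Z_0 = {0}`. -/
def ZDisk {n : ℕ} (σ : Fin n → ℂ) (Λ : Fin n → ℝ) (ω : ℂ) : Set ℂ :=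
  {ζ | (ω = 0 ∧ ζ = 0) ∨
    (ω ≠ 0 ∧ ‖ζ / (2 * ω ^ 2) - ∑ k, conj (σ k) / ((|Λ k| : ℝ) : ℂ)‖
      ≤ 2 * (1 / ω).re - invSum Λ)}

/-- The value region of `(G''(0), λ(G))` over the class of generators with Denjoy-Wolff
point `0`. -/
def valueRegion {n : ℕ} (σ : Fin n → ℂ) (Λ : Fin n → ℝ) : Set (ℂ × ℂ) :=
  valuePair '' Gen 0 σ Λ

/-- The number `1/ω - (1/2) ∑ 1 / |λ_k|`. -/
def ell {n : ℕ} (Λ : Fin n → ℝ) (ω : ℂ) : ℂ := 1 / ω - ((invSum Λ / 2 : ℝ) : ℂ)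

/-- The extremal function with parameters `ω ∈ int Ω` and `s ∈ ∂𝔻`. -/
def extremalInt {n : ℕ} (σ : Fin n → ℂ) (Λ : Fin n → ℝ) (ω s z : ℂ) : ℂ :=
  -(z / ((s + z) / (s - z) * ((ell Λ ω).re : ℂ) + Complex.I * ((ell Λ ω).im : ℂ)
    + pZero 0 σ Λ z))

/-- The extremal function with parameter `ω ∈ ∂Ω \ {0}`. -/
def extremalBdry {n : ℕ} (σ : Fin n → ℂ) (Λ : Fin n → ℝ) (ω z : ℂ) : ℂ :=
  -(z / (Complex.I * ((ell Λ ω).im : ℂ) + pZero 0 σ Λ z))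

/-- The explicit list of extremal functions `E` that belong to the value `λ(E) = ω`. -/
def IsExtremal {n : ℕ} (σ : Fin n → ℂ) (Λ : Fin n → ℝ) (ω : ℂ) (E : ℂ → ℂ) : Prop :=
  (ω ∈ interior (Omega Λ) ∧ ∃ s : ℂ, ‖s‖ = 1 ∧ E = extremalInt σ Λ ω s) ∨
    (ω ∈ frontier (Omega Λ) ∧ ω ≠ 0 ∧ E = extremalBdry σ Λ ω) ∨
    (ω = 0 ∧ E = fun _ => 0)

end

end DiskSemigroup

/-!
A generator with Denjoy-Wolff point `0` is `G z = -z p z` with `Re p ≥ 0` (Berkson-Porta). By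
Julia's lemma for `1 / p`, a spectral value in `[λ_k, 0]` at `σ_k` means that `1 / p` has a radial
mass of at least `1 / (2 |λ_k|)` at `σ_k`. Removing these masses leaves a function `q` with
`Re q ≥ 0` and `G = -z / (q + p₀)`. Here `λ(G) = 1 / (q(0) + p₀(0))`, and `G''(0)` is an affine
function of `q'(0)`, so that the whole theorem is the inequality `|q'(0)| ≤ 2 Re q(0)`, in which
equality holds only for the Möbius functions `q`.

Conversely, each Möbius `q` yields a generator. The flow exists because `Re (conj z * G z) ≤ 0`.
The difference of two trajectories has a controlled logarithmic derivative, so its quotient by the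
initial difference tends to the exponential of an integral as one trajectory tends to an interior
point or to a fixed point on the circle; this gives the holomorphy of the flow as well as its
angular derivatives at the `σ_k`.
-/

namespace DiskSemigroup

/-! ### Trajectories of vector fields -/

section IntegralCurves

open scoped NNReal

variable {E : Type*} [NormedAddCommGroup E]

theorem norm_le_of_inner_deriv_nonpos [InnerProductSpace ℝ E] {y y' : ℝ → E}
    (hy : ∀ t ∈ Ici 0, HasDerivWithinAt y (y' t) (Ici 0) t)
    (hinner : ∀ t ∈ Ici 0, inner ℝ (y t) (y' t) ≤ 0) {t : ℝ} (ht : 0 ≤ t) :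
    ‖y t‖ ≤ ‖y 0‖ := by
  have hsq : ∀ t ∈ Ici 0,
      HasDerivWithinAt (fun s => ‖y s‖ ^ 2) (2 * inner ℝ (y t) (y' t)) (Ici 0) t :=
    fun t ht => (hy t ht).norm_sq
  have hanti : AntitoneOn (fun s => ‖y s‖ ^ 2) (Ici 0) :=
    antitoneOn_of_hasDerivWithinAt_nonpos (convex_Ici 0)
      (fun t ht => (hsq t ht).continuousWithinAt)
      (fun t ht => (hsq t (interior_subset ht)).mono interior_subset)
      (fun t ht => by linarith [hinner t (interior_subset ht)])
  exact le_of_sq_le_sq (hanti self_mem_Ici ht ht) (norm_nonneg _)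

section Lipschitz

variable [NormedSpace ℝ E] {V : E → E} {K : ℝ≥0} {S : Set E} {y w : ℝ → E}

theorem exists_isIntegralCurveOn_Ici_of_forall_Icc {v : ℝ → E → E} {x : E}
    (hv : ∀ t, LipschitzWith K (v t))
    (hex : ∀ T : ℝ, ∃ y : ℝ → E, y 0 = x ∧ IsIntegralCurveOn y v (Icc 0 T)) :
    ∃ y : ℝ → E, y 0 = x ∧ IsIntegralCurveOn y v (Ici 0) := by
  choose Y hY0 hY using hex
  have hagree : ∀ T₁ T₂ s : ℝ, 0 ≤ s → s ≤ T₁ → s ≤ T₂ → Y T₁ s = Y T₂ s := by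
    intro T₁ T₂ s hs h₁ h₂
    have hYs : ∀ T, s ≤ T → IsIntegralCurveOn (Y T) v (Icc 0 s) := fun T hT =>
      (hY T).mono (Icc_subset_Icc_right hT)
    have hright : ∀ T, s ≤ T → ∀ t ∈ Ico 0 s, HasDerivWithinAt (Y T) (v t (Y T t)) (Ici t) t :=
      fun T hT t ht =>
        (hYs T hT t (Ico_subset_Icc_self ht)).mono_of_mem_nhdsWithin (Icc_mem_nhdsGE_of_mem ht)
    exact ODE_solution_unique hv (hYs T₁ h₁).continuousOn (hright T₁ h₁)
      (hYs T₂ h₂).continuousOn (hright T₂ h₂) ((hY0 T₁).trans (hY0 T₂).symm) ⟨hs, le_rfl⟩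
  refine ⟨fun t => Y t t, hY0 0, fun t ht => ?_⟩
  have hlocal : HasDerivWithinAt (Y (t + 1)) (v t (Y (t + 1) t)) (Ici 0) t := by
    refine (hY (t + 1) t ⟨ht, by linarith⟩).mono_of_mem_nhdsWithin ?_
    rw [← Ici_inter_Iic]
    exact inter_mem_nhdsWithin _ (Iic_mem_nhds (by linarith))
  have heq : ∀ s ∈ Ici (0 : ℝ), s ≤ t + 1 → Y s s = Y (t + 1) s := fun s hs hst =>
    hagree s (t + 1) s hs le_rfl hst
  rw [← heq t ht (by linarith)] at hlocal
  refine hlocal.congr_of_eventuallyEq ?_ (heq t ht (by linarith))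
  filter_upwards [self_mem_nhdsWithin,
    mem_nhdsWithin_of_mem_nhds (Iic_mem_nhds (by linarith : t < t + 1))] using heq

theorem exists_isIntegralCurveOn_Ici [CompleteSpace E] (hV : LipschitzWith K V) {C : ℝ≥0}
    (hC : ∀ x, ‖V x‖ ≤ C) (x : E) :
    ∃ y : ℝ → E, y 0 = x ∧ IsIntegralCurveOn y (fun _ => V) (Ici 0) := by
  refine exists_isIntegralCurveOn_Ici_of_forall_Icc (fun _ => hV) fun T => ?_
  have hPL : IsPicardLindelof (fun _ => V) (tmin := 0) (tmax := |T|) ⟨0, by simp⟩ x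
      (C * ‖T‖₊) 0 C K :=
    .of_time_independent (fun x _ => hC x) hV.lipschitzOnWith (by simp)
  obtain ⟨y, hy0, hy⟩ := hPL.exists_eq_forall_mem_Icc_hasDerivWithinAt₀
  exact ⟨y, hy0, IsIntegralCurveOn.mono hy (Icc_subset_Icc_right (le_abs_self T))⟩

theorem dist_le_dist_mul_exp_of_isIntegralCurveOn (hV : LipschitzOnWith K V S)
    (hy : IsIntegralCurveOn y (fun _ => V) (Ici 0)) (hyS : MapsTo y (Ici 0) S)
    (hw : IsIntegralCurveOn w (fun _ => V) (Ici 0)) (hwS : MapsTo w (Ici 0) S)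
    {t : ℝ} (ht : 0 ≤ t) : dist (y t) (w t) ≤ dist (y 0) (w 0) * Real.exp (K * t) := by
  have hright : ∀ {γ : ℝ → E}, IsIntegralCurveOn γ (fun _ => V) (Ici 0) →
      ∀ s ∈ Ico 0 t, HasDerivWithinAt γ (V (γ s)) (Ici s) s :=
    fun hγ s hs => (hγ s hs.1).mono (Ici_subset_Ici.2 hs.1)
  simpa using dist_le_of_trajectories_ODE_of_mem (v := fun _ => V) (s := fun _ => S)
    (fun _ _ => hV) (hy.continuousOn.mono Icc_subset_Ici_self) (hright hy)
    (fun s hs => hyS hs.1) (hw.continuousOn.mono Icc_subset_Ici_self) (hright hw)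
    (fun s hs => hwS hs.1) le_rfl t ⟨ht, le_rfl⟩

theorem ne_of_isIntegralCurveOn_of_ne (hV : LipschitzOnWith K V S)
    (hy : IsIntegralCurveOn y (fun _ => V) (Ici 0)) (hyS : MapsTo y (Ici 0) S)
    (hw : IsIntegralCurveOn w (fun _ => V) (Ici 0)) (hwS : MapsTo w (Ici 0) S)
    (hne : y 0 ≠ w 0) {t : ℝ} (ht : 0 ≤ t) : y t ≠ w t := by
  have hleft : ∀ {γ : ℝ → E}, IsIntegralCurveOn γ (fun _ => V) (Ici 0) →
      ∀ s ∈ Ioc 0 t, HasDerivWithinAt γ (V (γ s)) (Iic s) s :=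
    fun hγ s hs => ((hγ s hs.1.le).hasDerivAt (Ici_mem_nhds hs.1)).hasDerivWithinAt
  refine fun heq => hne ?_
  exact ODE_solution_unique_of_mem_Icc_left (v := fun _ => V) (s := fun _ => S)
    (fun _ _ => hV) (hy.continuousOn.mono Icc_subset_Ici_self) (hleft hy)
    (fun s hs => hyS hs.1.le) (hw.continuousOn.mono Icc_subset_Ici_self) (hleft hw)
    (fun s hs => hwS hs.1.le) heq ⟨le_rfl, ht⟩

theorem norm_le_exp_mul_of_norm_deriv_le {y y' : ℝ → E} {L R T : ℝ} (hL : 0 ≤ L)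
    (hy : ∀ t ∈ Icc 0 T, HasDerivWithinAt y (y' t) (Icc 0 T) t) (hne : y 0 ≠ 0)
    (hR : ‖y 0‖ * Real.exp ((L + 1) * T) ≤ R)
    (hbound : ∀ t ∈ Ico 0 T, ‖y t‖ ≤ R → ‖y' t‖ ≤ L * ‖y t‖) :
    ∀ t ∈ Icc 0 T, ‖y t‖ ≤ ‖y 0‖ * Real.exp ((L + 1) * t) := by
  have hexp : ∀ t, HasDerivAt (fun t => ‖y 0‖ * Real.exp ((L + 1) * t))
      (‖y 0‖ * (Real.exp ((L + 1) * t) * (L + 1))) t := fun t =>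
    (((hasDerivAt_id t).const_mul (L + 1)).congr_deriv (mul_one _)).exp.const_mul _
  refine image_norm_le_of_norm_deriv_right_lt_deriv_boundary
    (fun t ht => (hy t ht).continuousWithinAt)
    (fun t ht => (hy t (Ico_subset_Icc_self ht)).mono_of_mem_nhdsWithin
      (Icc_mem_nhdsGE_of_mem ht)) (by simp) hexp fun t ht heq => ?_
  have hle : ‖y t‖ ≤ R := by
    have htT := ht.2.le
    exact heq.trans_le (hR.trans' (by gcongr))
  have hpos : 0 < ‖y t‖ := by rw [heq]; positivity
  calc ‖y' t‖ ≤ L * ‖y t‖ := hbound t ht hle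
    _ < (L + 1) * ‖y t‖ := by linarith
    _ = ‖y 0‖ * (Real.exp ((L + 1) * t) * (L + 1)) := by rw [heq]; ring

end Lipschitz

theorem exists_isIntegralCurveOn_of_inner_nonpos [InnerProductSpace ℝ E] [FiniteDimensional ℝ E]
    {V : E → E} {r : ℝ} (hV : ContDiffOn ℝ 1 V (Metric.ball 0 r))
    (hinner : ∀ x ∈ Metric.ball 0 r, inner ℝ x (V x) ≤ 0) {x : E} (hx : x ∈ Metric.ball 0 r) :
    ∃ y : ℝ → E, y 0 = x ∧ IsIntegralCurveOn y (fun _ => V) (Ici 0) ∧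
      ∀ t, 0 ≤ t → ‖y t‖ ≤ ‖x‖ := by
  obtain ⟨R, hxR, hRr⟩ := exists_between (mem_ball_zero_iff.1 hx)
  have hR0 : 0 < R := (norm_nonneg x).trans_lt hxR
  let χ : ContDiffBump (0 : E) := ⟨R, (R + r) / 2, hR0, by linarith⟩
  let W : E → E := fun x => χ x • V x
  have hsupp : tsupport χ ⊆ Metric.ball 0 r := by
    rw [χ.tsupport_eq]
    exact Metric.closedBall_subset_ball (show (R + r) / 2 < r by linarith)
  have hWcompact : HasCompactSupport W := χ.hasCompactSupport.smul_right
  have hWsmooth : ContDiff ℝ 1 W := by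
    refine contMDiff_iff_contDiff.1 (contMDiff_of_tsupport fun x hx => ContDiffAt.contMDiffAt ?_)
    have hxr := hsupp (tsupport_smul_subset_left _ _ hx)
    exact χ.contDiff.contDiffAt.smul (hV.contDiffAt (Metric.isOpen_ball.mem_nhds hxr))
  obtain ⟨K, hK⟩ := hWsmooth.lipschitzWith_of_hasCompactSupport hWcompact one_ne_zero
  obtain ⟨C, hC⟩ := hWcompact.exists_bound_of_continuous hWsmooth.continuous
  obtain ⟨y, hy0, hy⟩ := exists_isIntegralCurveOn_Ici hK
    (fun x => (hC x).trans (Real.le_coe_toNNReal C)) x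
  have hWinner : ∀ x, inner ℝ x (W x) ≤ 0 := by
    intro x
    rw [real_inner_smul_right]
    by_cases hxr : x ∈ Metric.ball 0 r
    · exact mul_nonpos_of_nonneg_of_nonpos χ.nonneg (hinner x hxr)
    · rw [image_eq_zero_of_notMem_tsupport fun hm => hxr (hsupp hm), zero_mul]
  have hle : ∀ t, 0 ≤ t → ‖y t‖ ≤ ‖x‖ := fun t ht =>
    hy0 ▸ norm_le_of_inner_deriv_nonpos hy (fun s _ => hWinner (y s)) ht
  refine ⟨y, hy0, fun t ht => ?_, hle⟩
  have hone : χ (y t) = 1 :=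
    χ.one_of_mem_closedBall (mem_closedBall_zero_iff.2 ((hle t ht).trans hxR.le))
  simpa only [W, hone, one_smul] using hy t ht

end IntegralCurves

section LogDeriv

variable {T : ℝ}

theorem eq_exp_integral_mul_of_hasDerivWithinAt {u a : ℝ → ℂ} (hT : 0 ≤ T)
    (ha : ContinuousOn a (Icc 0 T))
    (hu : ∀ t ∈ Icc 0 T, HasDerivWithinAt u (a t * u t) (Icc 0 T) t) :
    u T = Complex.exp (∫ s in (0 : ℝ)..T, a s) * u 0 := by
  let A : ℝ → ℂ := fun t => ∫ s in (0 : ℝ)..t, a s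
  have hA : ∀ t ∈ Icc 0 T, HasDerivWithinAt A (a t) (Icc 0 T) t := by
    intro t ht
    have := Fact.mk ht
    exact intervalIntegral.integral_hasDerivWithinAt_right
      ((ha.mono (Icc_subset_Icc_right ht.2)).intervalIntegrable_of_Icc ht.1)
      (ha.stronglyMeasurableAtFilter_nhdsWithin measurableSet_Icc t) (ha t ht)
  have hderiv : ∀ t ∈ Icc 0 T,
      HasDerivWithinAt (fun t => Complex.exp (-A t) * u t) 0 (Icc 0 T) t := fun t ht =>
    ((hA t ht).fun_neg.cexp.mul (hu t ht)).congr_deriv (by ring)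
  have hconst : Complex.exp (-A T) * u T = Complex.exp (-A 0) * u 0 :=
    constant_of_has_deriv_right_zero (fun t ht => (hderiv t ht).continuousWithinAt)
      (fun t ht => (hderiv t (Ico_subset_Icc_self ht)).mono_of_mem_nhdsWithin
        (Icc_mem_nhdsGE_of_mem ht)) T ⟨hT, le_rfl⟩
  have hA0 : A 0 = 0 := intervalIntegral.integral_same
  rw [hA0, neg_zero, Complex.exp_zero, one_mul, Complex.exp_neg] at hconst
  rw [← hconst, mul_inv_cancel_left₀ (Complex.exp_ne_zero _)]

theorem tendsto_div_of_tendsto_logDeriv {ι : Type*} {l : Filter ι} [l.IsCountablyGenerated]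
    {u v : ι → ℝ → ℂ} {b : ℝ → ℂ} {L : ℝ} (hT : 0 ≤ T)
    (hu : ∀ᶠ i in l, ∀ t ∈ Icc 0 T, HasDerivWithinAt (u i) (v i t) (Icc 0 T) t)
    (hv : ∀ᶠ i in l, ContinuousOn (v i) (Icc 0 T))
    (hne : ∀ᶠ i in l, ∀ t ∈ Icc 0 T, u i t ≠ 0)
    (hL : ∀ᶠ i in l, ∀ t ∈ Icc 0 T, ‖v i t / u i t‖ ≤ L)
    (hb : ∀ t ∈ Icc 0 T, Tendsto (fun i => v i t / u i t) l (𝓝 (b t))) :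
    Tendsto (fun i => u i T / u i 0) l (𝓝 (Complex.exp (∫ s in (0 : ℝ)..T, b s))) := by
  have hmem : ∀ {t}, t ∈ uIoc 0 T → t ∈ Icc 0 T := fun ht =>
    Ioc_subset_Icc_self (uIoc_of_le hT ▸ ht)
  have hcont : ∀ᶠ i in l, ContinuousOn (fun t => v i t / u i t) (Icc 0 T) := by
    filter_upwards [hu, hv, hne] with i hui hvi hnei
    exact hvi.div (fun t ht => (hui t ht).continuousWithinAt) hnei
  have hintegral : Tendsto (fun i => ∫ s in (0 : ℝ)..T, v i s / u i s) l
      (𝓝 (∫ s in (0 : ℝ)..T, b s)) := by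
    refine intervalIntegral.tendsto_integral_filter_of_dominated_convergence (fun _ => L) ?_ ?_
      intervalIntegrable_const (Eventually.of_forall fun t ht => hb t (hmem ht))
    · filter_upwards [hcont] with i hi
      exact (hi.mono fun t => hmem).aestronglyMeasurable measurableSet_uIoc
    · filter_upwards [hL] with i hi using Eventually.of_forall fun t ht => hi t (hmem ht)
  refine ((Complex.continuous_exp.tendsto _).comp hintegral).congr' ?_
  filter_upwards [hu, hcont, hne] with i hui hi hnei
  have hexp := eq_exp_integral_mul_of_hasDerivWithinAt hT hi fun t ht =>
    (hui t ht).congr_deriv (div_mul_cancel₀ _ (hnei t ht)).symm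
  exact ((div_eq_iff (hnei 0 ⟨le_rfl, hT⟩)).2 hexp).symm

end LogDeriv

/-! ### Flows of dissipative holomorphic vector fields on the disk -/

section Flow

variable {G : ℂ → ℂ} {φ : ℝ → ℂ → ℂ} {z : ℂ} {t : ℝ}

theorem zero_mem_disk : (0 : ℂ) ∈ disk := Metric.mem_ball_self one_pos

theorem sub_ne_zero_of_mem_disk {σ : ℂ} (hσ : ‖σ‖ = 1) (hz : z ∈ disk) : σ - z ≠ 0 := by
  rw [sub_ne_zero]
  rintro rfl
  exact (mem_ball_zero_iff.1 hz).ne hσ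

/-- `φ` is a forward flow of the vector field `G` on the disk along which the modulus does not
increase. In contrast to `IsGenerator`, neither holomorphy nor the semigroup law is required: both
follow, see `IsContractiveFlow.isGenerator`. -/
structure IsContractiveFlow (G : ℂ → ℂ) (φ : ℝ → ℂ → ℂ) : Prop where
  zero : ∀ z ∈ disk, φ 0 z = z
  isIntegralCurveOn : ∀ z ∈ disk, IsIntegralCurveOn (fun t => φ t z) (fun _ => G) (Ici 0)
  norm_le : ∀ z ∈ disk, ∀ t, 0 ≤ t → ‖φ t z‖ ≤ ‖z‖

theorem exists_lipschitzOnWith_closedBall (hG : DifferentiableOn ℂ G disk) {R : ℝ} (hR : R < 1) :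
    ∃ K, LipschitzOnWith K G (Metric.closedBall 0 R) := by
  have hsub : Metric.closedBall (0 : ℂ) R ⊆ disk := Metric.closedBall_subset_ball hR
  have hG1 : ContDiffOn ℝ 1 G (Metric.closedBall 0 R) :=
    ((hG.contDiffOn Metric.isOpen_ball).restrict_scalars ℝ).mono hsub
  exact (hG1.locallyLipschitzOn (convex_closedBall 0 R)).exists_lipschitzOnWith_of_compact
    (isCompact_closedBall 0 R)

namespace IsContractiveFlow

variable (hφ : IsContractiveFlow G φ)

include hφ

theorem mapsTo_closedBall {R : ℝ} (hR : R < 1) (hz : ‖z‖ ≤ R) :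
    MapsTo (fun t => φ t z) (Ici 0) (Metric.closedBall 0 R) := fun t ht =>
  mem_closedBall_zero_iff.2
    ((hφ.norm_le z (mem_ball_zero_iff.2 (hz.trans_lt hR)) t ht).trans hz)

theorem mapsTo_disk (ht : 0 ≤ t) : MapsTo (φ t) disk disk := fun z hz =>
  mem_ball_zero_iff.2 ((hφ.norm_le z hz t ht).trans_lt (mem_ball_zero_iff.1 hz))

theorem apply_zero (ht : 0 ≤ t) : φ t 0 = 0 := by
  simpa using hφ.norm_le 0 zero_mem_disk t ht

theorem apply_add (hG : DifferentiableOn ℂ G disk) (hz : z ∈ disk) {s : ℝ} (hs : 0 ≤ s)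
    (ht : 0 ≤ t) : φ (s + t) z = φ s (φ t z) := by
  have hz1 := mem_ball_zero_iff.1 hz
  obtain ⟨K, hK⟩ := exists_lipschitzOnWith_closedBall hG hz1
  have htz := hφ.mapsTo_disk ht hz
  have hshift : IsIntegralCurveOn (fun u => φ (u + t) z) (fun _ => G) (Ici 0) :=
    ((hφ.isIntegralCurveOn z hz).comp_add t).mono fun u hu =>
      mem_vadd_set_iff_neg_vadd_mem.2 (by simpa [add_comm] using add_nonneg hu ht)
  have hdist := dist_le_dist_mul_exp_of_isIntegralCurveOn hK hshift
    (fun u hu => hφ.mapsTo_closedBall hz1 le_rfl (add_nonneg hu ht))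
    (hφ.isIntegralCurveOn _ htz)
    (hφ.mapsTo_closedBall hz1 (hφ.norm_le z hz t ht)) hs
  rw [zero_add, hφ.zero _ htz, dist_self, zero_mul] at hdist
  exact dist_le_zero.1 hdist

theorem tendsto_apply_nhdsNE (hG : DifferentiableOn ℂ G disk) (hz : z ∈ disk) (ht : 0 ≤ t) :
    Tendsto (φ t) (𝓝[≠] z) (𝓝[≠] (φ t z)) := by
  obtain ⟨R, hzR, hR⟩ := exists_between (mem_ball_zero_iff.1 hz)
  obtain ⟨K, hK⟩ := exists_lipschitzOnWith_closedBall hG hR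
  have hev : ∀ᶠ w in 𝓝[≠] z, ‖w‖ < R :=
    (continuous_norm.continuousAt.eventually_lt_const hzR).filter_mono nhdsWithin_le_nhds
  have hlim : Tendsto (fun w => dist w z * Real.exp (K * t)) (𝓝[≠] z) (𝓝 0) := by
    have : Continuous fun w => dist w z * Real.exp (K * t) := by fun_prop
    simpa using (this.tendsto z).mono_left nhdsWithin_le_nhds
  refine tendsto_nhdsWithin_iff.2 ⟨tendsto_iff_dist_tendsto_zero.2
    (squeeze_zero' (.of_forall fun _ => dist_nonneg) ?_ hlim), ?_⟩
  all_goals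
    filter_upwards [hev, self_mem_nhdsWithin] with w hwR hwz
    have hw : w ∈ disk := mem_ball_zero_iff.2 (hwR.trans hR)
  · simpa only [hφ.zero w hw, hφ.zero z hz] using dist_le_dist_mul_exp_of_isIntegralCurveOn hK
      (hφ.isIntegralCurveOn w hw) (hφ.mapsTo_closedBall hR hwR.le)
      (hφ.isIntegralCurveOn z hz) (hφ.mapsTo_closedBall hR hzR.le) ht
  · exact ne_of_isIntegralCurveOn_of_ne hK
      (hφ.isIntegralCurveOn w hw) (hφ.mapsTo_closedBall hR hwR.le)
      (hφ.isIntegralCurveOn z hz) (hφ.mapsTo_closedBall hR hzR.le)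
      (by rw [hφ.zero w hw, hφ.zero z hz]; exact hwz) ht

theorem hasDerivAt (hG : DifferentiableOn ℂ G disk) (hz : z ∈ disk) (ht : 0 ≤ t) :
    HasDerivAt (φ t) (Complex.exp (∫ s in (0 : ℝ)..t, deriv G (φ s z))) z := by
  obtain ⟨R, hzR, hR⟩ := exists_between (mem_ball_zero_iff.1 hz)
  obtain ⟨K, hK⟩ := exists_lipschitzOnWith_closedBall hG hR
  have hsub : Metric.closedBall (0 : ℂ) R ⊆ disk := Metric.closedBall_subset_ball hR
  have hmem : ∀ᶠ w in 𝓝[≠] z, ‖w‖ ≤ R :=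
    (continuous_norm.continuousAt.eventually_le_const hzR).filter_mono nhdsWithin_le_nhds
  have hcurve := fun {w : ℂ} (hw : ‖w‖ ≤ R) =>
    hφ.isIntegralCurveOn w (hsub (mem_closedBall_zero_iff.2 hw))
  have hcont : ∀ {w : ℂ}, ‖w‖ ≤ R → ContinuousOn (fun s => G (φ s w)) (Icc 0 t) := fun hw =>
    (hG.continuousOn.comp (hcurve hw).continuousOn
      fun s hs => hsub (hφ.mapsTo_closedBall hR hw hs)).mono Icc_subset_Ici_self
  have hzz := hφ.zero z hz
  have hquot := tendsto_div_of_tendsto_logDeriv (l := 𝓝[≠] z) (L := K)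
    (u := fun w s => φ s w - φ s z) (v := fun w s => G (φ s w) - G (φ s z))
    (b := fun s => deriv G (φ s z)) ht
    (hmem.mono fun w hw s hs => ((hcurve hw s hs.1).sub (hcurve hzR.le s hs.1)).mono
      Icc_subset_Ici_self)
    (hmem.mono fun w hw => (hcont hw).sub (hcont hzR.le))
    (by
      filter_upwards [hmem, self_mem_nhdsWithin] with w hw hwz s hs
      refine sub_ne_zero.2 (ne_of_isIntegralCurveOn_of_ne hK (hcurve hw)
        (hφ.mapsTo_closedBall hR hw) (hcurve hzR.le) (hφ.mapsTo_closedBall hR hzR.le) ?_ hs.1)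
      rwa [hφ.zero w (hsub (mem_closedBall_zero_iff.2 hw)), hzz])
    (hmem.mono fun w hw s hs => by
      rw [norm_div]
      exact div_le_of_le_mul₀ (norm_nonneg _) K.coe_nonneg (hK.norm_sub_le
        (hφ.mapsTo_closedBall hR hw hs.1) (hφ.mapsTo_closedBall hR hzR.le hs.1)))
    (fun s hs => by
      have hGs := (hG.differentiableAt (Metric.isOpen_ball.mem_nhds (hφ.mapsTo_disk hs.1 hz)))
      simpa only [Function.comp_def, slope_def_field] using
        (hasDerivAt_iff_tendsto_slope.1 hGs.hasDerivAt).comp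
          (hφ.tendsto_apply_nhdsNE hG hz hs.1))
  refine hasDerivAt_iff_tendsto_slope.2 (hquot.congr' ?_)
  filter_upwards [hmem] with w hw
  rw [hφ.zero w (hsub (mem_closedBall_zero_iff.2 hw)), hzz, slope_def_field]

theorem isGenerator (hG : DifferentiableOn ℂ G disk) : IsGenerator G φ where
  isSemigroup :=
    { differentiableOn := fun _ ht _ hz =>
        (hφ.hasDerivAt hG hz ht).differentiableAt.differentiableWithinAt
      mapsTo := fun _ ht => hφ.mapsTo_disk ht
      zero := hφ.zero
      add := fun _ _ hs ht _ hz => hφ.apply_add hG hz hs ht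
      tendsto := fun z hz => by
        have h := (hφ.isIntegralCurveOn z hz).continuousWithinAt (t₀ := 0) self_mem_Ici
        simpa only [hφ.zero z hz] using
          h.tendsto.mono_left (nhdsWithin_mono _ Ioi_subset_Ici_self) }
  differentiableOn := hG
  hasDeriv := hφ.isIntegralCurveOn

theorem hasDerivAt_zero (hG : DifferentiableOn ℂ G disk) (ht : 0 ≤ t) :
    HasDerivAt (φ t) (Complex.exp (deriv G 0 * t)) 0 := by
  have hintegral : ∫ s in (0 : ℝ)..t, deriv G (φ s 0) = deriv G 0 * t := by
    rw [intervalIntegral.integral_congr (g := fun _ => deriv G 0) fun s hs => by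
      simp only [hφ.apply_zero (uIcc_of_le ht ▸ hs).1]]
    simp [mul_comm]
  exact hintegral ▸ hφ.hasDerivAt hG zero_mem_disk ht

end IsContractiveFlow

variable (hre : ∀ z ∈ disk, (conj z * G z).re ≤ 0)

include hre

theorem inner_nonpos_of_mem_disk (hz : z ∈ disk) : inner ℝ z (G z) ≤ 0 := by
  rw [Complex.inner, mul_comm]
  exact hre z hz

theorem exists_isGenerator (hG : DifferentiableOn ℂ G disk) : ∃ φ, IsGenerator G φ := by
  have hG1 : ContDiffOn ℝ 1 G disk :=
    (hG.contDiffOn Metric.isOpen_ball).restrict_scalars ℝ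
  have hex : ∀ z : ℂ, ∃ y : ℝ → ℂ, z ∈ disk → y 0 = z ∧
      IsIntegralCurveOn y (fun _ => G) (Ici 0) ∧ ∀ t, 0 ≤ t → ‖y t‖ ≤ ‖z‖ := by
    intro z
    by_cases hz : z ∈ disk
    · exact (exists_isIntegralCurveOn_of_inner_nonpos hG1
        (fun _ => inner_nonpos_of_mem_disk hre) hz).imp fun _ hy _ => hy
    · exact ⟨0, fun h => absurd h hz⟩
  choose Y hY using hex
  have hflow : IsContractiveFlow G fun t z => Y z t :=
    ⟨fun z hz => (hY z hz).1, fun z hz => (hY z hz).2.1, fun z hz => (hY z hz).2.2⟩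
  exact ⟨_, hflow.isGenerator hG⟩

namespace IsGenerator

variable (hφ : IsGenerator G φ)

include hφ

theorem isContractiveFlow : IsContractiveFlow G φ where
  zero := hφ.isSemigroup.zero
  isIntegralCurveOn := hφ.hasDeriv
  norm_le z hz t ht := by
    simpa only [hφ.isSemigroup.zero z hz] using norm_le_of_inner_deriv_nonpos (hφ.hasDeriv z hz)
      (fun s hs => inner_nonpos_of_mem_disk hre (hφ.isSemigroup.mapsTo s hs hz)) ht

theorem semigroupDWPoint : SemigroupDWPoint φ 0 := fun _ ht hne =>
  ⟨hne, .inl ⟨zero_mem_disk, (hφ.isContractiveFlow hre).apply_zero ht⟩⟩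

end IsGenerator

end Flow

section SpectralValue

variable {G : ℂ → ℂ} {φ : ℝ → ℂ → ℂ}

theorem eq_of_forall_exp_mul_eq {a b : ℂ}
    (h : ∀ t : ℝ, 0 ≤ t → Complex.exp (a * t) = Complex.exp (b * t)) : a = b := by
  have hderiv : ∀ c : ℂ,
      HasDerivWithinAt (fun t : ℝ => Complex.exp (c * t)) c (Ici 0) 0 := fun c => by
    have hlin : HasDerivAt (fun t : ℝ => c * (t : ℂ)) (c * 1) 0 :=
      Complex.ofRealCLM.hasDerivAt.const_mul c
    simpa using hlin.cexp.hasDerivWithinAt (s := Ici 0)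
  have hb := (hderiv b).congr (fun t ht => h t ht) (h 0 le_rfl)
  exact (uniqueDiffWithinAt_Ici (0 : ℝ)).eq_deriv _ (hderiv a) hb

theorem IsGenerator.isSpectralValue_iff (hφ : IsGenerator G φ)
    (hre : ∀ z ∈ disk, (conj z * G z).re ≤ 0) {l : ℂ} :
    IsSpectralValue G 0 l ↔ l = -deriv G 0 := by
  have hderiv {ψ : ℝ → ℂ → ℂ} (hψ : IsGenerator G ψ) {t : ℝ} (ht : 0 ≤ t) :
      HasDerivAt (ψ t) (Complex.exp (deriv G 0 * t)) 0 :=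
    (hψ.isContractiveFlow hre).hasDerivAt_zero hψ.differentiableOn ht
  constructor
  · rintro ⟨ψ, hψ, h⟩
    refine neg_eq_iff_eq_neg.1 (eq_of_forall_exp_mul_eq fun t ht => ?_)
    rw [(hderiv hψ ht).unique (h t ht), neg_mul]
  · rintro rfl
    refine ⟨φ, hφ, fun t ht => ?_⟩
    rw [neg_mul, neg_neg]
    exact hderiv hφ ht

theorem IsGenerator.spectralValue_eq (hφ : IsGenerator G φ)
    (hre : ∀ z ∈ disk, (conj z * G z).re ≤ 0) : spectralValue G 0 = -deriv G 0 :=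
  (hφ.isSpectralValue_iff hre).1 (Classical.epsilon_spec ⟨_, (hφ.isSpectralValue_iff hre).2 rfl⟩)

end SpectralValue

section BoundaryFixedPoint

variable {G : ℂ → ℂ} {φ : ℝ → ℂ → ℂ} {σ : ℂ}

theorem hasAngularLimit_of_tendsto {f : ℂ → ℂ} {l : ℂ} (h : Tendsto f (𝓝[disk] σ) (𝓝 l)) :
    HasAngularLimit f σ l :=
  fun _ => h.mono_left (nhdsWithin_mono _ fun _ hz => hz.1)

theorem exists_norm_le_mul_norm_sub_of_tendsto {μ : ℂ} (hσ : ‖σ‖ = 1)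
    (h : Tendsto (fun z => G z / (σ - z)) (𝓝[disk] σ) (𝓝 μ)) :
    ∃ L R, 0 ≤ L ∧ 0 < R ∧ ∀ z ∈ disk, ‖z - σ‖ ≤ R → ‖G z‖ ≤ L * ‖z - σ‖ := by
  have hev := h.norm.eventually_le_const (lt_add_one ‖μ‖)
  obtain ⟨R, hR, hball⟩ :=
    (nhdsWithin_hasBasis Metric.nhds_basis_closedBall disk).mem_iff.1 hev
  refine ⟨‖μ‖ + 1, R, by positivity, hR, fun z hz hzR => ?_⟩
  have hle : ‖G z / (σ - z)‖ ≤ ‖μ‖ + 1 := hball ⟨mem_closedBall_iff_norm.2 hzR, hz⟩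
  rwa [norm_div, div_le_iff₀ (norm_pos_iff.2 (sub_ne_zero_of_mem_disk hσ hz)),
    norm_sub_rev σ z] at hle

theorem tendsto_norm_sub_mul_nhdsWithin (s : Set ℂ) (c : ℝ) :
    Tendsto (fun z => ‖z - σ‖ * c) (𝓝[s] σ) (𝓝 0) := by
  have hcont : Continuous fun z => ‖z - σ‖ * c := by fun_prop
  simpa using (hcont.tendsto σ).mono_left nhdsWithin_le_nhds

namespace IsGenerator

variable (hφ : IsGenerator G φ) (hσ : ‖σ‖ = 1)

include hφ hσ

theorem norm_sub_le_mul_exp {z : ℂ} {L R T : ℝ} (hL : 0 ≤ L)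
    (hG : ∀ z ∈ disk, ‖z - σ‖ ≤ R → ‖G z‖ ≤ L * ‖z - σ‖) (hz : z ∈ disk)
    (hzR : ‖z - σ‖ * Real.exp ((L + 1) * T) ≤ R) :
    ∀ t ∈ Icc 0 T, ‖φ t z - σ‖ ≤ ‖z - σ‖ * Real.exp ((L + 1) * t) := by
  have h0 := hφ.isSemigroup.zero z hz
  have := norm_le_exp_mul_of_norm_deriv_le (y := fun t => φ t z - σ) (y' := fun t => G (φ t z))
    (T := T) (R := R) hL
    (fun t ht => ((hφ.hasDeriv z hz t ht.1).mono Icc_subset_Ici_self).sub_const σ)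
    (by rw [h0, ← neg_ne_zero, neg_sub]; exact sub_ne_zero_of_mem_disk hσ hz)
    (by rwa [h0])
    (fun t ht => hG _ (hφ.isSemigroup.mapsTo t ht.1 hz))
  simpa only [h0] using this

theorem tendsto_nhdsWithin_disk {μ : ℂ}
    (h : Tendsto (fun z => G z / (σ - z)) (𝓝[disk] σ) (𝓝 μ)) {t : ℝ} (ht : 0 ≤ t) :
    Tendsto (φ t) (𝓝[disk] σ) (𝓝[disk] σ) := by
  obtain ⟨L, R, hL, hR, hLR⟩ := exists_norm_le_mul_norm_sub_of_tendsto hσ h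
  have hclose := tendsto_norm_sub_mul_nhdsWithin (σ := σ) disk (Real.exp ((L + 1) * t))
  refine tendsto_nhdsWithin_iff.2 ⟨tendsto_iff_norm_sub_tendsto_zero.2
    (squeeze_zero' (.of_forall fun _ => norm_nonneg _) ?_ hclose),
    eventually_mem_nhdsWithin.mono fun z hz => hφ.isSemigroup.mapsTo t ht hz⟩
  filter_upwards [hclose.eventually_le_const hR, self_mem_nhdsWithin] with z hzR hz
  exact hφ.norm_sub_le_mul_exp hσ hL hLR hz hzR t (right_mem_Icc.2 ht)

theorem tendsto_sub_div_sub {μ : ℂ} (h : Tendsto (fun z => G z / (σ - z)) (𝓝[disk] σ) (𝓝 μ))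
    {T : ℝ} (hT : 0 ≤ T) :
    Tendsto (fun z => (φ T z - σ) / (z - σ)) (𝓝[disk] σ) (𝓝 (Complex.exp (-μ * T))) := by
  obtain ⟨L, R, hL, hR, hLR⟩ := exists_norm_le_mul_norm_sub_of_tendsto hσ h
  have hmaps : ∀ {z t}, z ∈ disk → t ∈ Icc 0 T → φ t z ∈ disk := fun hz ht =>
    hφ.isSemigroup.mapsTo _ ht.1 hz
  have hstay : ∀ᶠ z in 𝓝[disk] σ, ‖z - σ‖ * Real.exp ((L + 1) * T) ≤ R :=
    (tendsto_norm_sub_mul_nhdsWithin _ _).eventually_le_const hR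
  have hquot := tendsto_div_of_tendsto_logDeriv (l := 𝓝[disk] σ) (L := L)
    (u := fun z t => φ t z - σ) (v := fun z t => G (φ t z)) (b := fun _ => -μ) hT
    (eventually_mem_nhdsWithin.mono fun z hz t ht =>
      ((hφ.hasDeriv z hz t ht.1).mono Icc_subset_Ici_self).sub_const σ)
    (eventually_mem_nhdsWithin.mono fun z hz => hφ.differentiableOn.continuousOn.comp
      (fun t ht => (hφ.hasDeriv z hz t ht.1).continuousWithinAt.mono Icc_subset_Ici_self)
      fun t ht => hmaps hz ht)
    (eventually_mem_nhdsWithin.mono fun z hz t ht => by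
      rw [← neg_ne_zero, neg_sub]
      exact sub_ne_zero_of_mem_disk hσ (hmaps hz ht))
    (by
      filter_upwards [hstay, self_mem_nhdsWithin] with z hzR hz t ht
      rw [norm_div]
      refine div_le_of_le_mul₀ (norm_nonneg _) hL (hLR _ (hmaps hz ht) ?_)
      exact (hφ.norm_sub_le_mul_exp hσ hL hLR hz hzR t ht).trans
        (le_trans (by gcongr; exact ht.2) hzR))
    (fun t ht => by
      simpa only [Function.comp_def, ← div_neg, neg_sub] using
        (h.comp (hφ.tendsto_nhdsWithin_disk hσ h ht.1)).neg)
  have hintegral : ∫ _ in (0 : ℝ)..T, -μ = -μ * T := by simp [mul_comm]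
  exact (hintegral ▸ hquot).congr' (eventually_mem_nhdsWithin.mono fun z hz => by
    rw [hφ.isSemigroup.zero z hz])

theorem semigroupBRFP {μ : ℂ} (h : Tendsto (fun z => G z / (σ - z)) (𝓝[disk] σ) (𝓝 μ)) :
    SemigroupBRFP φ σ := fun _ ht =>
  ⟨hσ, hasAngularLimit_of_tendsto ((hφ.tendsto_nhdsWithin_disk hσ h ht).mono_right
    nhdsWithin_le_nhds), _, hasAngularLimit_of_tendsto (hφ.tendsto_sub_div_sub hσ h ht)⟩

end IsGenerator

end BoundaryFixedPoint

/-! ### Functions with non-negative real part -/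

section Caratheodory

variable {q : ℂ → ℂ} {z w σ : ℂ}

/-- `q` is a Carathéodory function: a holomorphic function on the disk with non-negative real part.
No normalisation at the origin is imposed, and imaginary constants are allowed. -/
structure IsCaratheodory (q : ℂ → ℂ) : Prop where
  differentiableOn : DifferentiableOn ℂ q disk
  re_nonneg : ∀ z ∈ disk, 0 ≤ (q z).re

/-- The Cayley transform of `q` normalised at the origin, a self-map of the closed unit disk that
fixes `0` whenever `q` has positive real part. -/
noncomputable def cayley (q : ℂ → ℂ) (z : ℂ) : ℂ := (q z - q 0) / (q z + conj (q 0))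

/-- The Carathéodory function whose value at the origin is `ℓ` and whose Cayley transform is
`z ↦ c * z`. -/
noncomputable def moebius (ℓ c z : ℂ) : ℂ := ℓ.re * ((1 + c * z) / (1 - c * z)) + Complex.I * ℓ.im

theorem disk_mem_nhds (hz : z ∈ disk) : disk ∈ 𝓝 z := Metric.isOpen_ball.mem_nhds hz

theorem norm_lt_one_of_mem_disk (hz : z ∈ disk) : ‖z‖ < 1 := mem_ball_zero_iff.1 hz

theorem sq_norm_add_conj_sub_sq_norm_sub (a b : ℂ) :
    ‖b + conj a‖ ^ 2 - ‖b - a‖ ^ 2 = 4 * a.re * b.re := by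
  simp only [Complex.sq_norm, Complex.normSq_apply, Complex.add_re, Complex.add_im, Complex.sub_re,
    Complex.sub_im, Complex.conj_re, Complex.conj_im]
  ring

theorem add_conj_ne_zero {a b : ℂ} (ha : 0 < a.re) (hb : 0 < b.re) : b + conj a ≠ 0 := fun h => by
  have hre := congrArg Complex.re h
  simp only [Complex.add_re, Complex.conj_re, Complex.zero_re] at hre
  linarith

theorem sq_norm_one_sub_conj_mul_sub (z w : ℂ) :
    ‖1 - conj w * z‖ ^ 2 - ‖z - w‖ ^ 2 = (1 - ‖z‖ ^ 2) * (1 - ‖w‖ ^ 2) := by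
  simp only [Complex.sq_norm, Complex.normSq_apply, Complex.mul_re, Complex.mul_im,
    Complex.sub_re, Complex.sub_im, Complex.conj_re, Complex.conj_im, Complex.one_re,
    Complex.one_im]
  ring

theorem mul_mem_disk {c : ℂ} (hc : ‖c‖ ≤ 1) (hz : z ∈ disk) : c * z ∈ disk := by
  rw [mem_ball_zero_iff, norm_mul]
  exact (mul_le_of_le_one_left (norm_nonneg z) hc).trans_lt (norm_lt_one_of_mem_disk hz)

theorem one_sub_mul_ne_zero {c : ℂ} (hc : ‖c‖ ≤ 1) (hz : z ∈ disk) : 1 - c * z ≠ 0 :=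
  sub_ne_zero_of_mem_disk norm_one (mul_mem_disk hc hz)

theorem one_sub_conj_mul_ne_zero (hz : z ∈ disk) (hw : w ∈ disk) : 1 - conj w * z ≠ 0 :=
  one_sub_mul_ne_zero ((Complex.norm_conj w).trans_le (norm_lt_one_of_mem_disk hw).le) hz

theorem sub_div_one_sub_conj_mul_mem_disk (hz : z ∈ disk) (hw : w ∈ disk) :
    (z - w) / (1 - conj w * z) ∈ disk := by
  have hne := norm_pos_iff.2 (one_sub_conj_mul_ne_zero hz hw)
  have hpos : ∀ {v : ℂ}, v ∈ disk → 0 < 1 - ‖v‖ ^ 2 := fun hv =>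
    sub_pos.2 (pow_lt_one₀ (norm_nonneg _) (norm_lt_one_of_mem_disk hv) two_ne_zero)
  rw [mem_ball_zero_iff, norm_div, div_lt_one hne]
  refine lt_of_pow_lt_pow_left₀ 2 hne.le (sub_pos.1 ?_)
  rw [sq_norm_one_sub_conj_mul_sub]
  exact mul_pos (hpos hz) (hpos hw)

theorem exists_mapsTo_disk_zero_eq (hz : z ∈ disk) (hw : w ∈ disk) :
    ∃ T : ℂ → ℂ, DifferentiableOn ℂ T disk ∧ MapsTo T disk disk ∧ T 0 = w ∧
      ∃ u ∈ disk, T u = z ∧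
        (1 - ‖u‖ ^ 2) * ‖1 - conj w * z‖ ^ 2 = (1 - ‖z‖ ^ 2) * (1 - ‖w‖ ^ 2) := by
  have hw' : -w ∈ disk := by simpa using hw
  have hu := sub_div_one_sub_conj_mul_mem_disk hz hw
  have hmul := div_mul_cancel₀ (z - w) (one_sub_conj_mul_ne_zero hz hw)
  refine ⟨fun u => (u - -w) / (1 - conj (-w) * u),
    (differentiableOn_id.sub_const _).div (by fun_prop) fun u hu => one_sub_conj_mul_ne_zero hu hw',
    fun u hu => sub_div_one_sub_conj_mul_mem_disk hu hw', by simp, _, hu, ?_, ?_⟩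
  · rw [div_eq_iff (one_sub_conj_mul_ne_zero hu hw'), map_neg]
    linear_combination hmul
  · rw [← sq_norm_one_sub_conj_mul_sub, sub_mul, one_mul, ← mul_pow, ← norm_mul, hmul]

namespace IsCaratheodory

theorem re_pos_or_eq_const (hq : IsCaratheodory q) :
    (∀ z ∈ disk, 0 < (q z).re) ∨ ∃ c, ∀ z ∈ disk, q z = c := by
  refine ((hq.differentiableOn.analyticOnNhd Metric.isOpen_ball).is_constant_or_isOpen
    (convex_ball (0 : ℂ) 1).isPreconnected).symm.imp_left fun hopen z hz => ?_
  have hsub : q '' disk ⊆ {w | 0 ≤ w.re} := image_subset_iff.2 hq.re_nonneg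
  have hinterior := (hopen disk subset_rfl Metric.isOpen_ball).subset_interior_iff.2 hsub
    (mem_image_of_mem q hz)
  rwa [Complex.interior_setOfPred_le_re] at hinterior

theorem re_pos (hq : IsCaratheodory q) (h0 : 0 < (q 0).re) (hz : z ∈ disk) : 0 < (q z).re := by
  rcases hq.re_pos_or_eq_const with h | ⟨c, hc⟩
  · exact h z hz
  · rwa [hc z hz, ← hc 0 zero_mem_disk]

theorem eq_apply_zero (hq : IsCaratheodory q) (h0 : (q 0).re = 0) (hz : z ∈ disk) :
    q z = q 0 := by
  rcases hq.re_pos_or_eq_const with h | ⟨c, hc⟩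
  · exact absurd h0 (h 0 zero_mem_disk).ne'
  · rw [hc z hz, hc 0 zero_mem_disk]

theorem inv (hq : IsCaratheodory q) (hne : ∀ z ∈ disk, q z ≠ 0) :
    IsCaratheodory fun z => (q z)⁻¹ where
  differentiableOn := hq.differentiableOn.inv hne
  re_nonneg z hz := by
    rw [Complex.inv_re]
    exact div_nonneg (hq.re_nonneg z hz) (Complex.normSq_nonneg _)

theorem add {p : ℂ → ℂ} (hq : IsCaratheodory q) (hp : IsCaratheodory p) :
    IsCaratheodory fun z => q z + p z :=
  ⟨hq.differentiableOn.add hp.differentiableOn, fun z hz =>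
    add_nonneg (hq.re_nonneg z hz) (hp.re_nonneg z hz)⟩

theorem differentiableOn_cayley (hq : IsCaratheodory q) (h0 : 0 < (q 0).re) :
    DifferentiableOn ℂ (cayley q) disk :=
  (hq.differentiableOn.sub_const _).div (hq.differentiableOn.add_const _) fun _ hz =>
    add_conj_ne_zero h0 (hq.re_pos h0 hz)

theorem mapsTo_cayley (hq : IsCaratheodory q) :
    MapsTo (cayley q) disk (Metric.closedBall 0 1) := fun z hz => by
  rw [mem_closedBall_zero_iff, cayley, norm_div]
  refine div_le_one_of_le₀ (le_of_sq_le_sq (sub_nonneg.1 ?_) (norm_nonneg _)) (norm_nonneg _)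
  rw [sq_norm_add_conj_sub_sq_norm_sub]
  have := hq.re_nonneg z hz
  have := hq.re_nonneg 0 zero_mem_disk
  positivity

theorem norm_sub_apply_zero_le (hq : IsCaratheodory q) (hz : z ∈ disk) :
    ‖q z - q 0‖ ≤ ‖z‖ * ‖q z + conj (q 0)‖ := by
  rcases (hq.re_nonneg 0 zero_mem_disk).eq_or_lt with h0 | h0
  · rw [hq.eq_apply_zero h0.symm hz, sub_self, norm_zero]
    positivity
  · have hschwarz := Complex.norm_le_norm_of_mapsTo_ball (hq.differentiableOn_cayley h0)
      hq.mapsTo_cayley (by simp [cayley]) (norm_lt_one_of_mem_disk hz)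
    rwa [cayley, norm_div,
      div_le_iff₀ (norm_pos_iff.2 (add_conj_ne_zero h0 (hq.re_pos h0 hz)))] at hschwarz

theorem norm_mul_one_sub_le (hq : IsCaratheodory q) (hz : z ∈ disk) :
    ‖q z‖ * (1 - ‖z‖) ≤ ‖q 0‖ * (1 + ‖z‖) := by
  have hschwarz := hq.norm_sub_apply_zero_le hz
  have hlower := norm_sub_norm_le (q z) (q 0)
  have hupper : ‖q z + conj (q 0)‖ ≤ ‖q z‖ + ‖q 0‖ := by
    simpa using norm_add_le (q z) (conj (q 0))
  nlinarith [norm_nonneg z]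

theorem re_apply_zero_mul_one_sub_le (hq : IsCaratheodory q) (hz : z ∈ disk) :
    (q 0).re * (1 - ‖z‖) ≤ (q z).re * (1 + ‖z‖) := by
  have hsq := pow_le_pow_left₀ (norm_nonneg _) (hq.norm_sub_apply_zero_le hz) 2
  have h0 := hq.re_nonneg 0 zero_mem_disk
  have hz0 := hq.re_nonneg z hz
  have hr0 := norm_nonneg z
  have hr1 := (norm_lt_one_of_mem_disk hz).le
  generalize ‖z‖ = r at *
  simp only [mul_pow, Complex.sq_norm, Complex.normSq_apply, Complex.add_re, Complex.add_im,
    Complex.sub_re, Complex.sub_im, Complex.conj_re, Complex.conj_im] at hsq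
  have hr2 : 0 ≤ 1 - r ^ 2 := sub_nonneg.2 (pow_le_one₀ hr0 hr1)
  have hre : ((q 0).re - (q z).re) ^ 2 ≤ (r * ((q z).re + (q 0).re)) ^ 2 := by
    linarith [mul_nonneg hr2 (sq_nonneg ((q z).im - (q 0).im))]
  linarith [abs_le_of_sq_le_sq' hre (by positivity)]

/-- The constant `4` is the limit of the sharp constants `(1 + ‖u‖) ^ 2` as `‖w‖ → 1`, the case
needed for Julia's lemma. -/
theorem re_mul_le_four_mul_re (hq : IsCaratheodory q) (hz : z ∈ disk) (hw : w ∈ disk) :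
    (q w).re * ((1 - ‖z‖ ^ 2) * (1 - ‖w‖ ^ 2)) ≤ 4 * (q z).re * ‖1 - conj w * z‖ ^ 2 := by
  obtain ⟨T, hTd, hTm, rfl, u, hu, rfl, hnorm⟩ := exists_mapsTo_disk_zero_eq hz hw
  have hcomp : IsCaratheodory (q ∘ T) :=
    ⟨hq.differentiableOn.comp hTd hTm, fun v hv => hq.re_nonneg _ (hTm hv)⟩
  have hu1 := (norm_lt_one_of_mem_disk hu).le
  have hbound : (q (T 0)).re * (1 - ‖u‖ ^ 2) ≤ 4 * (q (T u)).re :=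
    calc (q (T 0)).re * (1 - ‖u‖ ^ 2) = (q (T 0)).re * (1 - ‖u‖) * (1 + ‖u‖) := by ring
      _ ≤ (q (T u)).re * (1 + ‖u‖) * (1 + ‖u‖) :=
        mul_le_mul_of_nonneg_right (hcomp.re_apply_zero_mul_one_sub_le hu) (by positivity)
      _ = (1 + ‖u‖) ^ 2 * (q (T u)).re := by ring
      _ ≤ (1 + 1) ^ 2 * (q (T u)).re := by
        gcongr
        exact hq.re_nonneg _ hz
      _ = 4 * (q (T u)).re := by ring
  rw [← hnorm, ← mul_assoc]
  gcongr

theorem norm_deriv_zero_le (hq : IsCaratheodory q) : ‖deriv q 0‖ ≤ 2 * (q 0).re := by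
  have hdiff := hq.differentiableOn.differentiableAt (disk_mem_nhds zero_mem_disk)
  have hright : ‖q 0 + conj (q 0)‖ = 2 * (q 0).re := by
    rw [Complex.add_conj, Complex.norm_real,
      Real.norm_of_nonneg (mul_nonneg zero_le_two (hq.re_nonneg 0 zero_mem_disk))]
  have hlim : Tendsto (fun z => ‖q z + conj (q 0)‖) (𝓝[≠] 0) (𝓝 ‖q 0 + conj (q 0)‖) :=
    ((hdiff.continuousAt.tendsto.mono_left nhdsWithin_le_nhds).add_const _).norm
  rw [← hright]
  refine le_of_tendsto_of_tendsto hdiff.hasDerivAt.tendsto_slope.norm hlim ?_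
  filter_upwards [self_mem_nhdsWithin, mem_nhdsWithin_of_mem_nhds (disk_mem_nhds zero_mem_disk)]
    with z hz0 hz
  rw [slope_def_field, norm_div, sub_zero, div_le_iff₀ (norm_pos_iff.2 hz0), mul_comm]
  exact hq.norm_sub_apply_zero_le hz

theorem cayley_eq_mul_of_deriv_zero_eq (hq : IsCaratheodory q) (h0 : 0 < (q 0).re) {c : ℂ}
    (hc : ‖c‖ = 1) (hd : deriv q 0 = 2 * (q 0).re * c) (hz : z ∈ disk) : cayley q z = c * z := by
  have hdiff := (hq.differentiableOn.differentiableAt (disk_mem_nhds zero_mem_disk)).hasDerivAt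
  have hne : q 0 + conj (q 0) ≠ 0 := add_conj_ne_zero h0 h0
  have hderiv : deriv (cayley q) 0 = c := by
    refine ((hdiff.sub_const (q 0)).div (hdiff.add_const (conj (q 0))) hne).deriv.trans ?_
    have hsum : 2 * ((q 0).re : ℂ) = q 0 + conj (q 0) := by rw [Complex.add_conj]; push_cast; rfl
    rw [sub_self, zero_mul, sub_zero, hd, hsum]
    field_simp
  have heq := Complex.affine_of_mapsTo_ball_of_norm_dslope_eq_div (R₂ := 1)
    (hq.differentiableOn_cayley h0) (by simpa [cayley] using hq.mapsTo_cayley) zero_mem_disk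
    (by rw [dslope_same, hderiv, hc, div_one]) hz
  simpa [dslope_same, hderiv, cayley, mul_comm] using heq

theorem eqOn_moebius (hq : IsCaratheodory q) {c : ℂ} (hc : ‖c‖ = 1)
    (hd : deriv q 0 = 2 * (q 0).re * c) : EqOn q (moebius (q 0) c) disk := fun z hz => by
  have hdecomp : q 0 = (q 0).re + (q 0).im * Complex.I := (Complex.re_add_im _).symm
  rw [moebius]
  rcases (hq.re_nonneg 0 zero_mem_disk).eq_or_lt with h0 | h0
  · rw [hq.eq_apply_zero h0.symm hz, ← h0, Complex.ofReal_zero, zero_mul, zero_add]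
    exact Complex.ext (by simp [← h0]) (by simp)
  · have heq := hq.cayley_eq_mul_of_deriv_zero_eq h0 hc hd hz
    have hconj : conj (q 0) = (q 0).re - (q 0).im * Complex.I := by
      apply Complex.ext <;> simp
    have hne := one_sub_mul_ne_zero hc.le hz
    rw [cayley, div_eq_iff (add_conj_ne_zero h0 (hq.re_pos h0 hz)), hconj] at heq
    field_simp
    linear_combination heq + hdecomp

end IsCaratheodory

theorem re_add_div_sub (hσ : ‖σ‖ = 1) (z : ℂ) :
    ((σ + z) / (σ - z)).re = (1 - ‖z‖ ^ 2) / ‖σ - z‖ ^ 2 := by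
  rw [← one_pow 2, ← hσ, Complex.div_re, ← add_div]
  simp only [Complex.sq_norm, Complex.normSq_apply (σ - z), Complex.normSq_apply σ,
    Complex.normSq_apply z, Complex.add_re, Complex.add_im, Complex.sub_re, Complex.sub_im]
  ring

theorem re_add_div_sub_pos (hσ : ‖σ‖ = 1) (hz : z ∈ disk) : 0 < ((σ + z) / (σ - z)).re := by
  rw [re_add_div_sub hσ]
  have hne := norm_pos_iff.2 (sub_ne_zero_of_mem_disk hσ hz)
  exact div_pos (sub_pos.2 (pow_lt_one₀ (norm_nonneg z) (norm_lt_one_of_mem_disk hz) two_ne_zero))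
    (by positivity)

theorem isCaratheodory_add_div_sub (hσ : ‖σ‖ = 1) :
    IsCaratheodory fun z => (σ + z) / (σ - z) where
  differentiableOn := (differentiableOn_id.const_add _).div (differentiableOn_id.const_sub _)
    fun _ hz => sub_ne_zero_of_mem_disk hσ hz
  re_nonneg _ hz := (re_add_div_sub_pos hσ hz).le

theorem ofReal_mul_mem_disk (hσ : ‖σ‖ = 1) {r : ℝ} (hr : r ∈ Ioo 0 1) : (r : ℂ) * σ ∈ disk := by
  rw [mem_ball_zero_iff, norm_mul, hσ, mul_one, Complex.norm_real, Real.norm_of_nonneg hr.1.le]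
  exact hr.2

theorem eventually_mem_Ioo_zero_one : ∀ᶠ r : ℝ in 𝓝[<] 1, r ∈ Ioo 0 1 :=
  Ioo_mem_nhdsLT one_pos

theorem norm_one_sub_conj_mul (hσ : ‖σ‖ = 1) (z : ℂ) : ‖1 - conj σ * z‖ = ‖σ - z‖ := by
  have hmul : σ * (1 - conj σ * z) = σ - z := by
    rw [mul_sub, ← mul_assoc, Complex.mul_conj, Complex.normSq_eq_norm_sq, hσ]
    simp
  rw [← hmul, norm_mul, hσ, one_mul]

theorem IsCaratheodory.mul_le_re_of_tendsto (hq : IsCaratheodory q) (hσ : ‖σ‖ = 1) {m : ℝ}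
    (hm : Tendsto (fun r : ℝ => (1 - r : ℂ) * q (r * σ)) (𝓝[<] 1) (𝓝 (2 * m))) (hz : z ∈ disk) :
    m * ((σ + z) / (σ - z)).re ≤ (q z).re := by
  have hleft : Tendsto (fun r : ℝ => ((1 - r : ℂ) * q (r * σ)).re * ((1 + r) * (1 - ‖z‖ ^ 2)))
      (𝓝[<] 1) (𝓝 ((2 * m : ℂ).re * ((1 + 1) * (1 - ‖z‖ ^ 2)))) := by
    have hcont : Continuous fun r : ℝ => (1 + r) * (1 - ‖z‖ ^ 2) := by fun_prop
    exact ((Complex.continuous_re.tendsto _).comp hm).mul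
      ((hcont.tendsto 1).mono_left nhdsWithin_le_nhds)
  have hright : Tendsto (fun r : ℝ => 4 * (q z).re * ‖1 - conj ((r : ℂ) * σ) * z‖ ^ 2)
      (𝓝[<] 1) (𝓝 (4 * (q z).re * ‖σ - z‖ ^ 2)) := by
    have hcont : Continuous fun r : ℝ => 4 * (q z).re * ‖1 - conj ((r : ℂ) * σ) * z‖ ^ 2 := by
      simp only [map_mul, Complex.conj_ofReal]
      fun_prop
    simpa [norm_one_sub_conj_mul hσ] using (hcont.tendsto 1).mono_left nhdsWithin_le_nhds
  have hle : (2 * m : ℂ).re * ((1 + 1) * (1 - ‖z‖ ^ 2)) ≤ 4 * (q z).re * ‖σ - z‖ ^ 2 := by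
    refine le_of_tendsto_of_tendsto hleft hright
      (eventually_mem_Ioo_zero_one.mono fun r hr => le_of_eq_of_le ?_
        (hq.re_mul_le_four_mul_re hz (ofReal_mul_mem_disk hσ hr)))
    have hre : ((1 - r : ℂ) * q (r * σ)).re = (1 - r) * (q (r * σ)).re := by
      rw [← Complex.ofReal_one, ← Complex.ofReal_sub, Complex.re_ofReal_mul]
    beta_reduce
    rw [hre, norm_mul, hσ, Complex.norm_real, mul_one, Real.norm_of_nonneg hr.1.le]
    ring
  have hne := norm_pos_iff.2 (sub_ne_zero_of_mem_disk hσ hz)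
  rw [re_add_div_sub hσ, ← mul_div_assoc, div_le_iff₀ (by positivity)]
  norm_num at hle
  linarith

theorem tendsto_one_sub_mul_sum_add_div_sub {ι : Type*} {s : Finset ι} {ξ : ι → ℂ}
    (hξ : ∀ k ∈ s, ξ k ≠ σ) (m : ι → ℝ) :
    Tendsto (fun r : ℝ => (1 - r : ℂ) * ∑ k ∈ s, (m k : ℂ) * ((ξ k + r * σ) / (ξ k - r * σ)))
      (𝓝[<] 1) (𝓝 0) := by
  have hcont : ContinuousAt (fun r : ℝ => (1 - r : ℂ) *
      ∑ k ∈ s, (m k : ℂ) * ((ξ k + r * σ) / (ξ k - r * σ))) 1 := by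
    refine ContinuousAt.mul (by fun_prop) (tendsto_finsetSum _ fun k hk => ?_)
    exact continuousAt_const.mul (ContinuousAt.div (by fun_prop) (by fun_prop)
      (by simpa [sub_eq_zero] using hξ k hk))
  simpa using hcont.tendsto.mono_left nhdsWithin_le_nhds

/-- Removing one pole at a time: by Julia's lemma the difference stays a Carathéodory function, and
its radial behaviour at the remaining poles is unchanged. -/
theorem IsCaratheodory.sub_sum (hq : IsCaratheodory q) {ι : Type*} {ξ : ι → ℂ}
    (hξ : ∀ k, ‖ξ k‖ = 1) (hinj : Function.Injective ξ) {m : ι → ℝ}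
    (hm : ∀ k, Tendsto (fun r : ℝ => (1 - r : ℂ) * q (r * ξ k)) (𝓝[<] 1) (𝓝 (2 * m k)))
    (s : Finset ι) :
    IsCaratheodory fun z => q z - ∑ k ∈ s, (m k : ℂ) * ((ξ k + z) / (ξ k - z)) := by
  classical
  have hd : ∀ s : Finset ι, DifferentiableOn ℂ
      (fun z => q z - ∑ k ∈ s, (m k : ℂ) * ((ξ k + z) / (ξ k - z))) disk := fun s =>
    hq.differentiableOn.sub (.fun_sum fun k _ =>
      (isCaratheodory_add_div_sub (hξ k)).differentiableOn.const_mul _)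
  refine ⟨hd s, ?_⟩
  induction s using Finset.induction_on with
  | empty => simpa using hq.re_nonneg
  | insert a s ha ih =>
    intro z hz
    have hlim := (hm a).sub (tendsto_one_sub_mul_sum_add_div_sub (σ := ξ a) (s := s)
      (fun k hk h => ha (hinj h ▸ hk)) m)
    rw [sub_zero] at hlim
    rw [Finset.sum_insert ha, add_comm, ← sub_sub, Complex.sub_re, sub_nonneg,
      Complex.re_ofReal_mul]
    exact (IsCaratheodory.mk (hd s) ih).mul_le_re_of_tendsto (hξ a) (hlim.congr fun r => by ring) hz

end Caratheodory

/-! ### The representation of generators -/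

section Radial

variable {f G p : ℂ → ℂ} {σ l : ℂ}

theorem sub_ofReal_mul (r : ℝ) (σ : ℂ) : σ - r * σ = ((1 - r : ℝ) : ℂ) * σ := by
  push_cast
  ring

theorem one_sub_ofReal_ne_zero {r : ℝ} (hr : r ∈ Ioo (0 : ℝ) 1) : (1 - r : ℂ) ≠ 0 :=
  sub_ne_zero.2 (by exact_mod_cast hr.2.ne')

theorem norm_ofReal_mul (hσ : ‖σ‖ = 1) {r : ℝ} (hr : r ∈ Ioo (0 : ℝ) 1) : ‖(r : ℂ) * σ‖ = r := by
  rw [norm_mul, hσ, mul_one, Complex.norm_real, Real.norm_of_nonneg hr.1.le]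

theorem HasAngularLimit.tendsto_radial (hσ : ‖σ‖ = 1) (h : HasAngularLimit f σ l) :
    Tendsto (fun r : ℝ => f (r * σ)) (𝓝[<] 1) (𝓝 l) := by
  refine (h 2).comp (tendsto_nhdsWithin_iff.2 ⟨?_, eventually_mem_Ioo_zero_one.mono fun r hr =>
    ⟨ofReal_mul_mem_disk hσ hr, ?_⟩⟩)
  · have hcont : Continuous fun r : ℝ => (r : ℂ) * σ := by fun_prop
    simpa using (hcont.tendsto 1).mono_left nhdsWithin_le_nhds
  · have hr1 : 0 < 1 - r := sub_pos.2 hr.2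
    rw [sub_ofReal_mul, norm_mul, norm_ofReal_mul hσ hr, hσ, Complex.norm_real,
      Real.norm_of_nonneg hr1.le]
    linarith

theorem HasBoundarySpectralValue.tendsto_radial {μ : ℝ} (hσ : ‖σ‖ = 1)
    (hGp : ∀ z ∈ disk, G z = -(z * p z)) (h : HasBoundarySpectralValue G σ μ) :
    Tendsto (fun r : ℝ => p (r * σ) / (1 - r : ℂ)) (𝓝[<] 1) (𝓝 (-μ)) := by
  have hinv : Tendsto (fun r : ℝ => -(r : ℂ)⁻¹) (𝓝[<] 1) (𝓝 (-1)) := by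
    have hcont : ContinuousAt (fun r : ℝ => -(r : ℂ)⁻¹) 1 :=
      (ContinuousAt.inv₀ (by fun_prop) (by simp)).neg
    simpa using hcont.tendsto.mono_left nhdsWithin_le_nhds
  have hmul := (HasAngularLimit.tendsto_radial hσ h).mul hinv
  rw [mul_neg_one] at hmul
  refine hmul.congr' (eventually_mem_Ioo_zero_one.mono fun r hr => ?_)
  have hσ0 : σ ≠ 0 := norm_ne_zero_iff.1 (hσ.trans_ne one_ne_zero)
  have hr0 : (r : ℂ) ≠ 0 := by exact_mod_cast hr.1.ne'
  have hr1 := one_sub_ofReal_ne_zero hr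
  rw [hGp _ (ofReal_mul_mem_disk hσ hr), sub_ofReal_mul]
  push_cast
  field_simp

theorem tendsto_zero_of_tendsto_div_one_sub
    (h : Tendsto (fun r : ℝ => p (r * σ) / (1 - r : ℂ)) (𝓝[<] 1) (𝓝 l)) :
    Tendsto (fun r : ℝ => p (r * σ)) (𝓝[<] 1) (𝓝 0) := by
  have hcont : Continuous fun r : ℝ => (1 - r : ℂ) := by fun_prop
  have hlim : Tendsto (fun r : ℝ => (1 - r : ℂ)) (𝓝[<] 1) (𝓝 0) := by
    simpa using (hcont.tendsto 1).mono_left nhdsWithin_le_nhds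
  have hmul := h.mul hlim
  rw [mul_zero] at hmul
  exact hmul.congr' (eventually_mem_Ioo_zero_one.mono fun r hr =>
    div_mul_cancel₀ _ (one_sub_ofReal_ne_zero hr))

namespace IsCaratheodory

theorem ne_zero_of_tendsto_zero (hp : IsCaratheodory p) (hσ : ‖σ‖ = 1)
    (h : Tendsto (fun r : ℝ => p (r * σ)) (𝓝[<] 1) (𝓝 0)) (hne : ¬ EqOn p 0 disk) {z : ℂ}
    (hz : z ∈ disk) : p z ≠ 0 := by
  rcases hp.re_pos_or_eq_const with hpos | ⟨c, hc⟩
  · exact fun h0 => (hpos z hz).ne' (by rw [h0, Complex.zero_re])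
  · have hlim : Tendsto (fun _ : ℝ => c) (𝓝[<] 1) (𝓝 0) :=
      h.congr' (eventually_mem_Ioo_zero_one.mono fun r hr => hc _ (ofReal_mul_mem_disk hσ hr))
    have hc0 : c = 0 := tendsto_nhds_unique tendsto_const_nhds hlim
    exact absurd (fun w hw => (hc w hw).trans hc0) hne

/-- A version of Hopf's lemma: a zero-free Carathéodory function cannot decay faster than linearly
along a radius, because its reciprocal grows at most linearly. -/
theorem radial_limit_ne_zero (hp : IsCaratheodory p) (hne : ∀ z ∈ disk, p z ≠ 0) (hσ : ‖σ‖ = 1)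
    (h : Tendsto (fun r : ℝ => p (r * σ) / (1 - r : ℂ)) (𝓝[<] 1) (𝓝 l)) : l ≠ 0 := by
  rintro rfl
  have hlim : Tendsto (fun r : ℝ => 2 * ‖(p 0)⁻¹‖ * ‖p (r * σ) / (1 - r : ℂ)‖) (𝓝[<] 1) (𝓝 0) := by
    simpa using h.norm.const_mul (2 * ‖(p 0)⁻¹‖)
  refine absurd (ge_of_tendsto hlim (eventually_mem_Ioo_zero_one.mono fun r hr => ?_))
    one_pos.not_ge
  have hr1 : 0 < 1 - r := sub_pos.2 hr.2
  have hnorm : ‖(1 - r : ℂ)‖ = 1 - r := by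
    rw [← Complex.ofReal_one, ← Complex.ofReal_sub, Complex.norm_real, Real.norm_of_nonneg hr1.le]
  have hmem := ofReal_mul_mem_disk hσ hr
  have hgrowth : ‖(p (r * σ))⁻¹‖ * (1 - r) ≤ ‖(p 0)⁻¹‖ * (1 + r) := by
    simpa only [norm_ofReal_mul hσ hr] using (hp.inv hne).norm_mul_one_sub_le hmem
  rw [norm_inv (p (r * σ)), inv_mul_le_iff₀ (norm_pos_iff.2 (hne _ hmem))] at hgrowth
  rw [norm_div, hnorm, ← mul_div_assoc, le_div_iff₀ hr1, one_mul]
  refine hgrowth.trans ?_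
  have hprod : 0 ≤ ‖p (r * σ)‖ * ‖(p 0)⁻¹‖ := by positivity
  nlinarith [hr.2]

theorem exists_tendsto_one_sub_mul_inv (hp : IsCaratheodory p) (hne : ∀ z ∈ disk, p z ≠ 0)
    (hσ : ‖σ‖ = 1) {a μ : ℝ} (ha : a ≤ μ) (hμ : μ ≤ 0)
    (h : Tendsto (fun r : ℝ => p (r * σ) / (1 - r : ℂ)) (𝓝[<] 1) (𝓝 (-μ))) :
    ∃ m : ℝ, 1 / (2 * |a|) ≤ m ∧
      Tendsto (fun r : ℝ => (1 - r : ℂ) * (p (r * σ))⁻¹) (𝓝[<] 1) (𝓝 (2 * m)) := by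
  have hμ0 := hp.radial_limit_ne_zero hne hσ h
  have hμ' : μ ≠ 0 := by simpa using hμ0
  refine ⟨1 / (2 * |μ|), ?_, ?_⟩
  · have hle : |μ| ≤ |a| := abs_le_abs_of_nonpos hμ ha
    gcongr
  · have hval : (-(μ : ℂ))⁻¹ = 2 * ((1 / (2 * |μ|) : ℝ) : ℂ) := by
      rw [abs_of_nonpos hμ]
      push_cast
      field_simp
    rw [← hval]
    exact (h.inv₀ hμ0).congr fun r => by rw [inv_div, div_eq_mul_inv]

end IsCaratheodory

end Radial

section BerksonPorta

variable {G p : ℂ → ℂ} {φ : ℝ → ℂ → ℂ} {z : ℂ}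

theorem nonpos_of_hasDerivWithinAt_of_le {f : ℝ → ℝ} {d : ℝ} (hf : HasDerivWithinAt f d (Ici 0) 0)
    (hle : ∀ t, 0 ≤ t → f t ≤ f 0) : d ≤ 0 := by
  have hslope := hasDerivWithinAt_iff_tendsto_slope.1 hf
  rw [Ici_sdiff_left] at hslope
  refine le_of_tendsto hslope (eventually_mem_nhdsWithin.mono fun t (ht : 0 < t) => ?_)
  rw [slope_def_field, sub_zero]
  exact div_nonpos_of_nonpos_of_nonneg (sub_nonpos.2 (hle t ht.le)) ht.le

theorem SemigroupDWPoint.apply_zero (hDW : SemigroupDWPoint φ 0) {t : ℝ} (ht : 0 ≤ t) :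
    φ t 0 = 0 := by
  by_cases h : EqOn (φ t) id disk
  · exact h zero_mem_disk
  · rcases (hDW t ht h).2 with hfix | hbdry
    · exact hfix.2
    · simpa using hbdry.2.1.1

theorem IsGenerator.re_conj_mul_nonpos (hφ : IsGenerator G φ) (hDW : SemigroupDWPoint φ 0)
    (hz : z ∈ disk) : (conj z * G z).re ≤ 0 := by
  have hzero := hφ.isSemigroup.zero z hz
  have hderiv := (hφ.hasDeriv z hz 0 le_rfl).norm_sq
  rw [Complex.inner, hzero, mul_comm (G z)] at hderiv
  refine nonpos_of_mul_nonpos_right (nonpos_of_hasDerivWithinAt_of_le hderiv fun t ht => ?_)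
    zero_lt_two
  have hschwarz := Complex.norm_le_norm_of_mapsTo_ball (hφ.isSemigroup.differentiableOn t ht)
    ((hφ.isSemigroup.mapsTo t ht).mono_right Metric.ball_subset_closedBall)
    (hDW.apply_zero ht) (norm_lt_one_of_mem_disk hz)
  rw [hzero]
  gcongr

theorem IsGenerator.map_zero (hφ : IsGenerator G φ) (hDW : SemigroupDWPoint φ 0) : G 0 = 0 := by
  have hderiv := hφ.hasDeriv 0 zero_mem_disk 0 le_rfl
  rw [hDW.apply_zero le_rfl] at hderiv
  exact (uniqueDiffWithinAt_Ici (0 : ℝ)).eq_deriv _ hderiv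
    ((hasDerivWithinAt_const _ _ 0).congr (fun _ ht => hDW.apply_zero ht) (hDW.apply_zero le_rfl))

theorem conj_mul_neg_mul (z w : ℂ) : conj z * -(z * w) = ((-‖z‖ ^ 2 : ℝ) : ℂ) * w := by
  have hsq : conj z * z = ((‖z‖ ^ 2 : ℝ) : ℂ) := by
    rw [mul_comm, Complex.mul_conj, Complex.normSq_eq_norm_sq]
  push_cast at hsq ⊢
  linear_combination -w * hsq

theorem exists_isCaratheodory_of_re_conj_mul_nonpos (hG : DifferentiableOn ℂ G disk)
    (h0 : G 0 = 0) (hre : ∀ z ∈ disk, (conj z * G z).re ≤ 0) :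
    ∃ p, IsCaratheodory p ∧ ∀ z, G z = -(z * p z) := by
  have hnhds := disk_mem_nhds zero_mem_disk
  have hd : DifferentiableOn ℂ (fun z => -dslope G 0 z) disk :=
    ((Complex.differentiableOn_dslope hnhds).2 hG).neg
  have heq : ∀ z, G z = -(z * -dslope G 0 z) := fun z => by
    have hslope := sub_smul_dslope G 0 z
    rw [sub_zero, h0, sub_zero, smul_eq_mul] at hslope
    rw [mul_neg, neg_neg, hslope]
  have hpos : ∀ z ∈ disk, z ≠ 0 → 0 ≤ (-dslope G 0 z).re := fun z hz hz0 => by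
    have hle := hre z hz
    rw [heq z, conj_mul_neg_mul, Complex.re_ofReal_mul] at hle
    exact nonneg_of_mul_nonpos_right hle (neg_neg_of_pos (pow_pos (norm_pos_iff.2 hz0) 2))
  refine ⟨_, ⟨hd, fun z hz => ?_⟩, heq⟩
  rcases eq_or_ne z 0 with rfl | hz0
  · have hcont : ContinuousAt (fun z => (-dslope G 0 z).re) 0 :=
      Complex.continuous_re.continuousAt.comp (hd.continuousOn.continuousAt hnhds)
    refine ge_of_tendsto (hcont.tendsto.mono_left (nhdsWithin_le_nhds (s := {0}ᶜ))) ?_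
    filter_upwards [self_mem_nhdsWithin, mem_nhdsWithin_of_mem_nhds hnhds] with w hw0 hw
      using hpos w hw hw0
  · exact hpos z hz hz0

theorem IsCaratheodory.re_conj_mul_nonpos (hp : IsCaratheodory p)
    (hGp : ∀ z ∈ disk, G z = -(z * p z)) (hz : z ∈ disk) : (conj z * G z).re ≤ 0 := by
  rw [hGp z hz, conj_mul_neg_mul, Complex.re_ofReal_mul]
  exact mul_nonpos_of_nonpos_of_nonneg (by simp) (hp.re_nonneg z hz)

theorem deriv_of_eq_neg_mul (hp : DifferentiableOn ℂ p disk) (hGp : ∀ z ∈ disk, G z = -(z * p z))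
    (hz : z ∈ disk) : deriv G z = -(p z + z * deriv p z) := by
  have hnhds := disk_mem_nhds hz
  have heq : G =ᶠ[𝓝 z] fun w => -(w * p w) := by filter_upwards [hnhds] with w hw using hGp w hw
  rw [heq.deriv_eq]
  refine ((hasDerivAt_id z).mul (hp.differentiableAt hnhds).hasDerivAt).neg.deriv.trans ?_
  simp

theorem iteratedDeriv_two_zero_of_eq_neg_mul (hp : DifferentiableOn ℂ p disk)
    (hGp : ∀ z ∈ disk, G z = -(z * p z)) : iteratedDeriv 2 G 0 = -(2 * deriv p 0) := by
  have hnhds := disk_mem_nhds zero_mem_disk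
  have hp' := (hp.deriv Metric.isOpen_ball).differentiableAt hnhds
  have heq : deriv G =ᶠ[𝓝 0] fun z => -(p z + z * deriv p z) := by
    filter_upwards [hnhds] with w hw using deriv_of_eq_neg_mul hp hGp hw
  rw [iteratedDeriv_succ, iteratedDeriv_one, heq.deriv_eq]
  refine ((hp.differentiableAt hnhds).hasDerivAt.add
    ((hasDerivAt_id 0).mul hp'.hasDerivAt)).neg.deriv.trans ?_
  simp only [one_mul, zero_mul, add_zero]
  ring

end BerksonPorta

section PZero

variable {n : ℕ} {σ : Fin n → ℂ} {Λ : Fin n → ℝ} {z : ℂ}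

theorem pZero_zero_eq (hσ : ∀ k, ‖σ k‖ = 1) (z : ℂ) :
    pZero 0 σ Λ z = ∑ k, ((1 / (2 * |Λ k|) : ℝ) : ℂ) * ((σ k + z) / (σ k - z)) := by
  simp [pZero, hσ]

theorem isCaratheodory_pZero (hσ : ∀ k, ‖σ k‖ = 1) : IsCaratheodory (pZero 0 σ Λ) where
  differentiableOn := .fun_sum fun k _ =>
    (isCaratheodory_add_div_sub (hσ k)).differentiableOn.const_mul _
  re_nonneg z hz := by
    rw [pZero_zero_eq hσ, Complex.re_sum]
    refine Finset.sum_nonneg fun k _ => ?_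
    rw [Complex.re_ofReal_mul]
    exact mul_nonneg (by positivity) (re_add_div_sub_pos (hσ k) hz).le

theorem re_pZero_pos (hn : 0 < n) (hσ : ∀ k, ‖σ k‖ = 1) (hΛ : ∀ k, Λ k < 0) (hz : z ∈ disk) :
    0 < (pZero 0 σ Λ z).re := by
  have : Nonempty (Fin n) := ⟨⟨0, hn⟩⟩
  rw [pZero_zero_eq hσ, Complex.re_sum]
  refine Finset.sum_pos (fun k _ => ?_) Finset.univ_nonempty
  have habs := abs_pos.2 (hΛ k).ne
  rw [Complex.re_ofReal_mul]
  exact mul_pos (by positivity) (re_add_div_sub_pos (hσ k) hz)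

theorem hasDerivAt_add_div_sub_zero {ξ : ℂ} (hξ : ‖ξ‖ = 1) :
    HasDerivAt (fun z => (ξ + z) / (ξ - z)) (2 * conj ξ) 0 := by
  have hξ0 : ξ ≠ 0 := norm_ne_zero_iff.1 (hξ.trans_ne one_ne_zero)
  refine (((hasDerivAt_id (0 : ℂ)).const_add ξ).div ((hasDerivAt_id (0 : ℂ)).const_sub ξ)
    (by simpa using hξ0)).congr_deriv ?_
  rw [← Complex.inv_eq_conj hξ]
  simp only [id_eq, sub_zero, add_zero]
  field_simp
  ring

theorem hasDerivAt_pZero_zero (hσ : ∀ k, ‖σ k‖ = 1) :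
    HasDerivAt (pZero 0 σ Λ) (∑ k, conj (σ k) / ((|Λ k| : ℝ) : ℂ)) 0 := by
  rw [show pZero 0 σ Λ = _ from funext (pZero_zero_eq hσ)]
  refine HasDerivAt.fun_sum fun k _ =>
    ((hasDerivAt_add_div_sub_zero (hσ k)).const_mul _).congr_deriv ?_
  push_cast
  rw [one_div, mul_inv, div_eq_mul_inv]
  ring

theorem pZero_zero_zero (hσ : ∀ k, ‖σ k‖ = 1) : pZero 0 σ Λ 0 = ((invSum Λ / 2 : ℝ) : ℂ) := by
  rw [pZero_zero_eq hσ, invSum, Finset.sum_div, Complex.ofReal_sum]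
  refine Finset.sum_congr rfl fun k _ => ?_
  have hσ0 : σ k ≠ 0 := norm_ne_zero_iff.1 ((hσ k).trans_ne one_ne_zero)
  rw [add_zero, sub_zero, div_self hσ0, mul_one, one_div, mul_inv, mul_comm, ← div_eq_mul_inv]

end PZero

/-- `q` is the Carathéodory part of `G`: what remains of `-z / G z` after the poles prescribed at
the points `σ k` have been removed. -/
structure IsCaratheodoryPart {n : ℕ} (σ : Fin n → ℂ) (Λ : Fin n → ℝ) (q G : ℂ → ℂ) : Prop where
  isCaratheodory : IsCaratheodory q
  eq_neg_div : ∀ z ∈ disk, G z = -(z / (q z + pZero 0 σ Λ z))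

theorem exists_isCaratheodoryPart {n : ℕ} {σ : Fin n → ℂ} {Λ : Fin n → ℝ} {G : ℂ → ℂ} (hn : 0 < n)
    (hσ : ∀ k, ‖σ k‖ = 1) (hinj : Function.Injective σ) (hG : G ∈ Gen 0 σ Λ)
    (hne : ¬ EqOn G 0 disk) : ∃ q, IsCaratheodoryPart σ Λ q G := by
  obtain ⟨φ, hφ, hDW, hfix⟩ := hG
  obtain ⟨p, hp, hGp⟩ := exists_isCaratheodory_of_re_conj_mul_nonpos hφ.differentiableOn
    (hφ.map_zero hDW) fun z hz => hφ.re_conj_mul_nonpos hDW hz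
  choose μ hle hμ hspec using fun k => (hfix k).2
  have hradial := fun k => (hspec k).tendsto_radial (hσ k) fun z _ => hGp z
  have hp0 : ∀ z ∈ disk, p z ≠ 0 := fun z => hp.ne_zero_of_tendsto_zero (hσ ⟨0, hn⟩)
    (tendsto_zero_of_tendsto_div_one_sub (hradial _)) fun h =>
      hne fun w hw => by rw [hGp, h hw]; simp
  choose m hΛm hm using fun k =>
    hp.exists_tendsto_one_sub_mul_inv hp0 (hσ k) (hle k) (hμ k) (hradial k)
  refine ⟨fun z => (p z)⁻¹ - pZero 0 σ Λ z,
    ⟨(hp.inv hp0).differentiableOn.sub (isCaratheodory_pZero hσ).differentiableOn, fun z hz => ?_⟩,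
    fun z _ => by rw [hGp, sub_add_cancel, div_inv_eq_mul]⟩
  refine ((hp.inv hp0).sub_sum hσ hinj hm Finset.univ).re_nonneg z hz |>.trans ?_
  rw [Complex.sub_re, Complex.sub_re, pZero_zero_eq hσ, Complex.re_sum, Complex.re_sum]
  refine sub_le_sub_left (Finset.sum_le_sum fun k _ => ?_) _
  rw [Complex.re_ofReal_mul, Complex.re_ofReal_mul]
  exact mul_le_mul_of_nonneg_right (hΛm k) (re_add_div_sub_pos (hσ k) hz).le

/-- The counterpart of `ell` for the first derivative: the value `q'(0)` of the Carathéodory part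
`q` of a generator with value pair `p`, provided that `p.2 ≠ 0`. -/
noncomputable def ellDeriv {n : ℕ} (σ : Fin n → ℂ) (Λ : Fin n → ℝ) (p : ℂ × ℂ) : ℂ :=
  p.1 / (2 * p.2 ^ 2) - ∑ k, conj (σ k) / ((|Λ k| : ℝ) : ℂ)

namespace IsCaratheodoryPart

variable {n : ℕ} {σ : Fin n → ℂ} {Λ : Fin n → ℝ} {q G : ℂ → ℂ} {z : ℂ}
  (hq : IsCaratheodoryPart σ Λ q G)

include hq

theorem eq_neg_mul_inv :
    ∀ z ∈ disk, G z = -(z * (q z + pZero 0 σ Λ z)⁻¹) := fun z hz => by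
  rw [hq.eq_neg_div z hz, div_eq_mul_inv]

theorem isCaratheodory_denominator (hσ : ∀ k, ‖σ k‖ = 1) :
    IsCaratheodory fun z => q z + pZero 0 σ Λ z :=
  hq.isCaratheodory.add (isCaratheodory_pZero hσ)

variable (hn : 0 < n) (hσ : ∀ k, ‖σ k‖ = 1) (hΛ : ∀ k, Λ k < 0)

include hn hσ hΛ

theorem re_denominator_pos (hz : z ∈ disk) : 0 < (q z + pZero 0 σ Λ z).re :=
  add_pos_of_nonneg_of_pos (hq.isCaratheodory.re_nonneg z hz) (re_pZero_pos hn hσ hΛ hz)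

theorem denominator_ne_zero (hz : z ∈ disk) : q z + pZero 0 σ Λ z ≠ 0 := fun h =>
  (hq.re_denominator_pos hn hσ hΛ hz).ne' (by rw [h, Complex.zero_re])

theorem isCaratheodory_inv : IsCaratheodory fun z => (q z + pZero 0 σ Λ z)⁻¹ :=
  (hq.isCaratheodory_denominator hσ).inv fun _ => hq.denominator_ne_zero hn hσ hΛ

theorem exists_isGenerator : ∃ φ, IsGenerator G φ ∧ SemigroupDWPoint φ 0 := by
  have hp := hq.isCaratheodory_inv hn hσ hΛ
  have hre : ∀ z ∈ disk, (conj z * G z).re ≤ 0 := fun z =>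
    hp.re_conj_mul_nonpos hq.eq_neg_mul_inv
  obtain ⟨φ, hφ⟩ := DiskSemigroup.exists_isGenerator hre
    ((differentiableOn_id.mul hp.differentiableOn).neg.congr hq.eq_neg_mul_inv)
  exact ⟨φ, hφ, hφ.semigroupDWPoint hre⟩

theorem spectralValue_eq : spectralValue G 0 = (q 0 + pZero 0 σ Λ 0)⁻¹ := by
  have hp := hq.isCaratheodory_inv hn hσ hΛ
  obtain ⟨φ, hφ, -⟩ := hq.exists_isGenerator hn hσ hΛ
  rw [hφ.spectralValue_eq fun z => hp.re_conj_mul_nonpos hq.eq_neg_mul_inv,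
    deriv_of_eq_neg_mul hp.differentiableOn hq.eq_neg_mul_inv zero_mem_disk, zero_mul, add_zero,
    neg_neg]

theorem spectralValue_ne_zero : spectralValue G 0 ≠ 0 := by
  rw [hq.spectralValue_eq hn hσ hΛ]
  exact inv_ne_zero (hq.denominator_ne_zero hn hσ hΛ zero_mem_disk)

theorem ell_spectralValue : ell Λ (spectralValue G 0) = q 0 := by
  rw [ell, hq.spectralValue_eq hn hσ hΛ, pZero_zero_zero hσ, one_div, inv_inv, add_sub_cancel_right]

theorem ellDeriv_valuePair : ellDeriv σ Λ (valuePair G) = deriv q 0 := by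
  have hne := hq.denominator_ne_zero hn hσ hΛ zero_mem_disk
  have hderiv := ((hq.isCaratheodory.differentiableOn.differentiableAt
    (disk_mem_nhds zero_mem_disk)).hasDerivAt.fun_add
      (hasDerivAt_pZero_zero (Λ := Λ) hσ)).fun_inv hne
  rw [ellDeriv, valuePair, iteratedDeriv_two_zero_of_eq_neg_mul
    (hq.isCaratheodory_inv hn hσ hΛ).differentiableOn hq.eq_neg_mul_inv, hderiv.deriv,
    hq.spectralValue_eq hn hσ hΛ]
  field_simp
  ring

end IsCaratheodoryPart

/-! ### The extremal generators -/

section Moebius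

variable {ℓ c ξ : ℂ}

theorem moebius_zero (ℓ c : ℂ) : moebius ℓ c 0 = ℓ := by
  rw [moebius, mul_zero, add_zero, sub_zero, div_one, mul_one, mul_comm Complex.I,
    Complex.re_add_im]

theorem hasDerivAt_moebius_zero (ℓ c : ℂ) : HasDerivAt (moebius ℓ c) (2 * ℓ.re * c) 0 := by
  have hmul : HasDerivAt (fun z : ℂ => c * z) c 0 := by
    simpa using (hasDerivAt_id (0 : ℂ)).const_mul c
  refine ((((hmul.const_add 1).div (hmul.const_sub 1) (by simp)).const_mul _).add_const
    _).congr_deriv ?_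
  simp only [mul_zero, sub_zero, add_zero, mul_one, one_mul, one_pow, div_one]
  ring

theorem isCaratheodory_moebius (hℓ : 0 ≤ ℓ.re) (hc : ‖c‖ ≤ 1) : IsCaratheodory (moebius ℓ c) where
  differentiableOn := (DifferentiableOn.const_mul (DifferentiableOn.div (by fun_prop) (by fun_prop)
    fun _ => one_sub_mul_ne_zero hc) _).add_const _
  re_nonneg z hz := by
    have hre := mul_nonneg hℓ (re_add_div_sub_pos norm_one (mul_mem_disk hc hz)).le
    simpa [moebius] using hre

theorem tendsto_sub_mul_of_continuousAt {f : ℂ → ℂ} {s : Set ℂ} (hf : ContinuousAt f ξ) :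
    Tendsto (fun z => (ξ - z) * f z) (𝓝[s] ξ) (𝓝 0) := by
  have hcont : ContinuousAt (fun z => (ξ - z) * f z) ξ := (by fun_prop : ContinuousAt _ ξ).mul hf
  simpa using hcont.tendsto.mono_left nhdsWithin_le_nhds

theorem tendsto_sub_mul_add_div_sub (hξ : ‖ξ‖ = 1) :
    Tendsto (fun z => (ξ - z) * ((ξ + z) / (ξ - z))) (𝓝[disk] ξ) (𝓝 (2 * ξ)) := by
  have hcont : Continuous fun z => ξ + z := by fun_prop
  refine ((hcont.tendsto' ξ (2 * ξ) (two_mul ξ).symm).mono_left nhdsWithin_le_nhds).congr' ?_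
  filter_upwards [self_mem_nhdsWithin] with z hz
  rw [mul_div_cancel₀ _ (sub_ne_zero_of_mem_disk hξ hz)]

theorem exists_tendsto_sub_mul_moebius (hℓ : 0 ≤ ℓ.re) (hξ : ‖ξ‖ = 1) :
    ∃ a : ℝ, 0 ≤ a ∧ (c * ξ ≠ 1 → a = 0) ∧
      Tendsto (fun z => (ξ - z) * moebius ℓ c z) (𝓝[disk] ξ) (𝓝 (2 * a * ξ)) := by
  by_cases hcξ : c * ξ = 1
  · refine ⟨ℓ.re, hℓ, fun h => absurd hcξ h, ?_⟩
    have hξ0 : ξ ≠ 0 := right_ne_zero_of_mul (hcξ.trans_ne one_ne_zero)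
    have hpole : ∀ z, moebius ℓ c z = ℓ.re * ((ξ + z) / (ξ - z)) + Complex.I * ℓ.im := fun z => by
      rw [moebius, ← mul_div_mul_left (1 + c * z) _ hξ0]
      congr 3
      · linear_combination z * hcξ
      · linear_combination -z * hcξ
    have hlim := ((tendsto_sub_mul_add_div_sub hξ).const_mul (ℓ.re : ℂ)).add
      (tendsto_sub_mul_of_continuousAt (ξ := ξ) (continuousAt_const (y := Complex.I * ℓ.im)))
    rw [add_zero, mul_left_comm, ← mul_assoc] at hlim
    refine hlim.congr fun z => ?_
    rw [hpole]
    ring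
  · refine ⟨0, le_rfl, fun _ => rfl, ?_⟩
    have hne : 1 - c * ξ ≠ 0 := sub_ne_zero.2 (Ne.symm hcξ)
    have hcont : ContinuousAt (moebius ℓ c) ξ := by
      unfold moebius
      fun_prop (disch := assumption)
    simpa using tendsto_sub_mul_of_continuousAt hcont

theorem tendsto_sub_mul_pZero {n : ℕ} {σ : Fin n → ℂ} {Λ : Fin n → ℝ} (hσ : ∀ k, ‖σ k‖ = 1)
    (hinj : Function.Injective σ) (k : Fin n) :
    Tendsto (fun z => (σ k - z) * pZero 0 σ Λ z) (𝓝[disk] (σ k))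
      (𝓝 (2 * ((1 / (2 * |Λ k|) : ℝ) : ℂ) * σ k)) := by
  have hterm : ∀ j, Tendsto (fun z => (σ k - z) * ((σ j + z) / (σ j - z))) (𝓝[disk] (σ k))
      (𝓝 (if j = k then 2 * σ k else 0)) := fun j => by
    split_ifs with hjk
    · exact hjk ▸ tendsto_sub_mul_add_div_sub (hσ j)
    · have hne : σ j - σ k ≠ 0 := sub_ne_zero.2 (hinj.ne hjk)
      exact tendsto_sub_mul_of_continuousAt (by fun_prop (disch := assumption))
  have hsum := tendsto_finsetSum Finset.univ fun j _ =>
    (hterm j).const_mul ((1 / (2 * |Λ j|) : ℝ) : ℂ)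
  simp only [mul_ite, mul_zero, Finset.sum_ite_eq', Finset.mem_univ, if_true] at hsum
  rw [mul_right_comm, mul_comm]
  refine hsum.congr fun z => ?_
  rw [pZero_zero_eq hσ, Finset.mul_sum]
  exact Finset.sum_congr rfl fun j _ => mul_left_comm _ _ _

theorem tendsto_neg_div_div_sub {f : ℂ → ℂ} {s : Set ℂ} {m : ℝ} (hξ : ξ ≠ 0) (hm : m ≠ 0)
    (hf : Tendsto (fun z => (ξ - z) * f z) (𝓝[s] ξ) (𝓝 (2 * m * ξ))) :
    Tendsto (fun z => -(z / f z) / (ξ - z)) (𝓝[s] ξ) (𝓝 ((-(1 / (2 * m)) : ℝ) : ℂ)) := by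
  have hm' : (m : ℂ) ≠ 0 := Complex.ofReal_ne_zero.2 hm
  have hlim := ((tendsto_nhdsWithin_of_tendsto_nhds tendsto_id).div hf
    (mul_ne_zero (mul_ne_zero two_ne_zero hm') hξ)).neg
  have hval : -(ξ / (2 * m * ξ)) = ((-(1 / (2 * m)) : ℝ) : ℂ) := by
    push_cast
    field_simp
  rw [← hval]
  refine hlim.congr fun z => ?_
  rw [neg_div, div_div, mul_comm (f z), Pi.div_apply, id_eq]

theorem exists_norm_eq_one_forall_mul_ne_one {n : ℕ} (σ : Fin n → ℂ) :
    ∃ c : ℂ, ‖c‖ = 1 ∧ ∀ k, c * σ k ≠ 1 := by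
  have hconn : IsPreconnected (Metric.sphere (0 : ℂ) 1) :=
    isPreconnected_sphere (by rw [Complex.rank_real_complex]; norm_num) _ _
  have hinf : (Metric.sphere (0 : ℂ) 1).Infinite :=
    hconn.infinite_of_nontrivial ⟨1, by simp, -1, by simp, by norm_num⟩
  obtain ⟨c, hc, hcσ⟩ := hinf.exists_notMem_finite (finite_range fun k => (σ k)⁻¹)
  exact ⟨c, by simpa using hc, fun k hk => hcσ ⟨k, (eq_inv_of_mul_eq_one_left hk).symm⟩⟩

end Moebius

section MoebiusGenerator

variable {n : ℕ} {σ : Fin n → ℂ} {Λ : Fin n → ℝ} {ω c : ℂ}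

/-- The function `-z / (q + p₀)` whose Carathéodory part `q` is the Möbius map with `q(0) = ℓ̂_ω`
and parameter `c`. The extremal generators are those with `‖c‖ = 1`. -/
noncomputable def moebiusGenerator (σ : Fin n → ℂ) (Λ : Fin n → ℝ) (ω c z : ℂ) : ℂ :=
  -(z / (moebius (ell Λ ω) c z + pZero 0 σ Λ z))

theorem ell_injective : Function.Injective (ell Λ) := fun a b h => by
  simpa [ell] using h

theorem isCaratheodoryPart_moebiusGenerator (hω : 0 ≤ (ell Λ ω).re) (hc : ‖c‖ ≤ 1) :
    IsCaratheodoryPart σ Λ (moebius (ell Λ ω) c) (moebiusGenerator σ Λ ω c) :=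
  ⟨isCaratheodory_moebius hω hc, fun _ _ => rfl⟩

variable (hn : 0 < n) (hσ : ∀ k, ‖σ k‖ = 1) (hΛ : ∀ k, Λ k < 0) (hω : 0 ≤ (ell Λ ω).re)

include hσ hΛ hω

theorem exists_tendsto_moebiusGenerator_div_sub (hinj : Function.Injective σ) (k : Fin n) :
    ∃ μ : ℝ, Λ k ≤ μ ∧ μ ≤ 0 ∧ (c * σ k ≠ 1 → μ = Λ k) ∧
      Tendsto (fun z => moebiusGenerator σ Λ ω c z / (σ k - z)) (𝓝[disk] (σ k)) (𝓝 μ) := by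
  obtain ⟨a, ha, hac, hlim⟩ := exists_tendsto_sub_mul_moebius (c := c) hω (hσ k)
  have habs := abs_pos.2 (hΛ k).ne
  have hm : 0 < a + 1 / (2 * |Λ k|) := by positivity
  have hΛk : -(1 / (2 * (1 / (2 * |Λ k|)))) = Λ k := by
    rw [abs_of_neg (hΛ k)]
    have := (hΛ k).ne
    field_simp
  refine ⟨-(1 / (2 * (a + 1 / (2 * |Λ k|)))), ?_, neg_nonpos.2 (by positivity), fun h => ?_,
    tendsto_neg_div_div_sub (norm_ne_zero_iff.1 ((hσ k).trans_ne one_ne_zero)) hm.ne' ?_⟩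
  · refine hΛk.symm.trans_le (neg_le_neg ?_)
    gcongr
    exact le_add_of_nonneg_left ha
  · rw [hac h, zero_add, hΛk]
  · convert hlim.add (tendsto_sub_mul_pZero (Λ := Λ) hσ hinj k) using 2
    · exact mul_add _ _ _
    · push_cast
      ring

include hn

theorem spectralValue_moebiusGenerator (hc : ‖c‖ ≤ 1) :
    spectralValue (moebiusGenerator σ Λ ω c) 0 = ω :=
  ell_injective <| ((isCaratheodoryPart_moebiusGenerator hω hc).ell_spectralValue hn hσ hΛ).trans
    (moebius_zero _ _)

theorem ellDeriv_valuePair_moebiusGenerator (hc : ‖c‖ ≤ 1) :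
    ellDeriv σ Λ (valuePair (moebiusGenerator σ Λ ω c)) = 2 * (ell Λ ω).re * c :=
  ((isCaratheodoryPart_moebiusGenerator hω hc).ellDeriv_valuePair hn hσ hΛ).trans
    (hasDerivAt_moebius_zero _ _).deriv

theorem moebiusGenerator_mem_Gen (hinj : Function.Injective σ) (hc : ‖c‖ ≤ 1) :
    moebiusGenerator σ Λ ω c ∈ Gen 0 σ Λ := by
  obtain ⟨φ, hφ, hDW⟩ :=
    (isCaratheodoryPart_moebiusGenerator hω hc).exists_isGenerator hn hσ hΛ
  refine ⟨φ, hφ, hDW, fun k => ?_⟩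
  obtain ⟨μ, hle, hμ, -, hlim⟩ := exists_tendsto_moebiusGenerator_div_sub hσ hΛ hω hinj k
  exact ⟨hφ.semigroupBRFP (hσ k) hlim, μ, hle, hμ, hasAngularLimit_of_tendsto hlim⟩

theorem moebiusGenerator_mem_GenExact (hinj : Function.Injective σ) (hc : ‖c‖ ≤ 1)
    (hne : ∀ k, c * σ k ≠ 1) : moebiusGenerator σ Λ ω c ∈ GenExact 0 σ Λ := by
  obtain ⟨φ, hφ, hDW⟩ :=
    (isCaratheodoryPart_moebiusGenerator hω hc).exists_isGenerator hn hσ hΛ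
  refine ⟨φ, hφ, hDW, fun k => ?_⟩
  obtain ⟨μ, -, -, hμ, hlim⟩ := exists_tendsto_moebiusGenerator_div_sub hσ hΛ hω hinj k
  exact ⟨hφ.semigroupBRFP (hσ k) hlim, hμ (hne k) ▸ hasAngularLimit_of_tendsto hlim⟩

end MoebiusGenerator

section Zero

theorem isGenerator_zero : IsGenerator (fun _ => 0) fun _ z => z where
  isSemigroup :=
    { differentiableOn := fun _ _ => differentiableOn_id
      mapsTo := fun _ _ => mapsTo_id _
      zero := fun _ _ => rfl
      add := fun _ _ _ _ _ _ => rfl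
      tendsto := fun _ _ => tendsto_const_nhds }
  differentiableOn := differentiableOn_const _
  hasDeriv := fun _ _ _ _ => hasDerivWithinAt_const _ _ _

theorem zero_mem_Gen {n : ℕ} {σ : Fin n → ℂ} {Λ : Fin n → ℝ} (hσ : ∀ k, ‖σ k‖ = 1)
    (hΛ : ∀ k, Λ k < 0) : (fun _ => 0) ∈ Gen 0 σ Λ := by
  refine ⟨_, isGenerator_zero, fun _ _ h => absurd (fun _ _ => rfl) h, fun k => ?_⟩
  have hlim : Tendsto (fun z => 0 / (σ k - z)) (𝓝[disk] (σ k)) (𝓝 ((0 : ℝ) : ℂ)) := by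
    simpa only [zero_div, Complex.ofReal_zero] using tendsto_const_nhds
  exact ⟨isGenerator_zero.semigroupBRFP (hσ k) hlim, 0, (hΛ k).le, le_rfl,
    hasAngularLimit_of_tendsto hlim⟩

theorem IsGenerator.valuePair_eq_zero {G : ℂ → ℂ} {φ : ℝ → ℂ → ℂ} (hφ : IsGenerator G φ)
    (h : EqOn G 0 disk) : valuePair G = 0 := by
  have hGp : ∀ z ∈ disk, G z = -(z * (0 : ℂ → ℂ) z) := fun z hz => by simp [h hz]
  have hdiff : DifferentiableOn ℂ (0 : ℂ → ℂ) disk := differentiableOn_const 0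
  rw [valuePair, hφ.spectralValue_eq fun z hz => by simp [h hz],
    iteratedDeriv_two_zero_of_eq_neg_mul hdiff hGp, deriv_of_eq_neg_mul hdiff hGp zero_mem_disk]
  simp

theorem valuePair_zero : valuePair (fun _ => 0) = 0 :=
  isGenerator_zero.valuePair_eq_zero fun _ _ => rfl

end Zero

/-! ### The shape of the value region -/

section Region

variable {n : ℕ} {σ : Fin n → ℂ} {Λ : Fin n → ℝ} {ω : ℂ} {p p' : ℂ × ℂ}

theorem invSum_pos (hn : 0 < n) (hΛ : ∀ k, Λ k < 0) : 0 < invSum Λ := by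
  have : Nonempty (Fin n) := ⟨⟨0, hn⟩⟩
  exact Finset.sum_pos (fun k _ => inv_pos.2 (abs_pos.2 (hΛ k).ne)) Finset.univ_nonempty

theorem Omega_eq_closedBall :
    Omega Λ = Metric.closedBall (((invSum Λ)⁻¹ : ℝ) : ℂ) (invSum Λ)⁻¹ := by
  ext w
  rw [mem_closedBall_iff_norm]
  rfl

theorem isClosed_Omega : IsClosed (Omega Λ) := by
  rw [Omega_eq_closedBall]
  exact Metric.isClosed_closedBall

theorem interior_Omega (hI : 0 < invSum Λ) :
    interior (Omega Λ) = Metric.ball (((invSum Λ)⁻¹ : ℝ) : ℂ) (invSum Λ)⁻¹ := by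
  rw [Omega_eq_closedBall, interior_closedBall _ (inv_pos.2 hI).ne']

theorem zero_mem_Omega (hI : 0 < invSum Λ) : 0 ∈ Omega Λ := by
  rw [Omega_eq_closedBall, mem_closedBall_iff_norm, zero_sub, norm_neg, Complex.norm_real,
    Real.norm_of_nonneg (inv_pos.2 hI).le]

theorem zero_notMem_interior_Omega (hI : 0 < invSum Λ) : (0 : ℂ) ∉ interior (Omega Λ) := by
  rw [interior_Omega hI, mem_ball_iff_norm, zero_sub, norm_neg, Complex.norm_real,
    Real.norm_of_nonneg (inv_pos.2 hI).le]
  exact lt_irrefl _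

theorem two_mul_re_ell (ω : ℂ) : 2 * (ell Λ ω).re = 2 * (1 / ω).re - ∑ k, 1 / |Λ k| := by
  simp only [ell, invSum, one_div, Complex.sub_re, Complex.ofReal_re]
  ring

theorem mul_re_ell (hI : 0 < invSum Λ) (hω : ω ≠ 0) :
    2 * ‖ω‖ ^ 2 * (ell Λ ω).re
      = invSum Λ * ((invSum Λ)⁻¹ ^ 2 - ‖ω - (((invSum Λ)⁻¹ : ℝ) : ℂ)‖ ^ 2) := by
  have hnorm : ‖ω - (((invSum Λ)⁻¹ : ℝ) : ℂ)‖ ^ 2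
      = ‖ω‖ ^ 2 - 2 * (invSum Λ)⁻¹ * ω.re + (invSum Λ)⁻¹ ^ 2 := by
    simp only [Complex.sq_norm, Complex.normSq_apply, Complex.sub_re, Complex.sub_im,
      Complex.ofReal_re, Complex.ofReal_im]
    ring
  rw [hnorm, ell, Complex.sub_re, Complex.ofReal_re, one_div, Complex.inv_re,
    Complex.normSq_eq_norm_sq]
  field_simp
  ring

theorem re_ell_nonneg_iff (hI : 0 < invSum Λ) (hω : ω ≠ 0) : 0 ≤ (ell Λ ω).re ↔ ω ∈ Omega Λ := by
  have hpos : 0 < 2 * ‖ω‖ ^ 2 := mul_pos two_pos (pow_pos (norm_pos_iff.2 hω) 2)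
  rw [← mul_nonneg_iff_of_pos_left hpos, mul_re_ell hI hω, mul_nonneg_iff_of_pos_left hI,
    sub_nonneg, pow_le_pow_iff_left₀ (norm_nonneg _) (inv_pos.2 hI).le two_ne_zero,
    Omega_eq_closedBall, mem_closedBall_iff_norm]

theorem re_ell_pos_iff (hI : 0 < invSum Λ) (hω : ω ≠ 0) :
    0 < (ell Λ ω).re ↔ ω ∈ interior (Omega Λ) := by
  have hpos : 0 < 2 * ‖ω‖ ^ 2 := mul_pos two_pos (pow_pos (norm_pos_iff.2 hω) 2)
  rw [← mul_pos_iff_of_pos_left hpos, mul_re_ell hI hω, mul_pos_iff_of_pos_left hI,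
    sub_pos, pow_lt_pow_iff_left₀ (norm_nonneg _) (inv_pos.2 hI).le two_ne_zero,
    interior_Omega hI, mem_ball_iff_norm]

theorem re_ell_eq_zero_of_mem_frontier (hI : 0 < invSum Λ) (hω : ω ≠ 0)
    (h : ω ∈ frontier (Omega Λ)) : (ell Λ ω).re = 0 := by
  rw [isClosed_Omega.frontier_eq] at h
  exact ((re_ell_nonneg_iff hI hω).2 h.1).antisymm'
    (not_lt.1 (mt (re_ell_pos_iff hI hω).1 h.2))

theorem eq_of_ellDeriv_eq (h0 : p.2 ≠ 0) (hsnd : p'.2 = p.2)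
    (h : ellDeriv σ Λ p' = ellDeriv σ Λ p) : p' = p := by
  rw [ellDeriv, ellDeriv, hsnd, sub_left_inj,
    div_left_inj' (mul_ne_zero two_ne_zero (pow_ne_zero 2 h0))] at h
  exact Prod.ext h hsnd

/-- The signed defect of the inequality `‖ellDeriv σ Λ p‖ ≤ 2 Re (ell Λ p.2)`, multiplied by
`2 ‖p.2‖²` so that it extends continuously to the points with `p.2 = 0`. -/
noncomputable def regionGap (σ : Fin n → ℂ) (Λ : Fin n → ℝ) (p : ℂ × ℂ) : ℝ :=
  2 * (invSum Λ * ((invSum Λ)⁻¹ ^ 2 - ‖p.2 - (((invSum Λ)⁻¹ : ℝ) : ℂ)‖ ^ 2))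
    - ‖p.1 - 2 * p.2 ^ 2 * ∑ k, conj (σ k) / ((|Λ k| : ℝ) : ℂ)‖

theorem continuous_regionGap : Continuous (regionGap σ Λ) := by
  unfold regionGap
  fun_prop

theorem regionGap_of_snd_eq_zero (hp : p.2 = 0) : regionGap σ Λ p = -‖p.1‖ := by
  simp [regionGap, hp]

theorem regionGap_of_snd_ne_zero (hI : 0 < invSum Λ) (hp : p.2 ≠ 0) :
    regionGap σ Λ p = 2 * ‖p.2‖ ^ 2 * (2 * (ell Λ p.2).re - ‖ellDeriv σ Λ p‖) := by
  have hfactor : p.1 - 2 * p.2 ^ 2 * ∑ k, conj (σ k) / ((|Λ k| : ℝ) : ℂ)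
      = 2 * p.2 ^ 2 * ellDeriv σ Λ p := by
    rw [ellDeriv, mul_sub, mul_div_cancel₀ _ (mul_ne_zero two_ne_zero (pow_ne_zero 2 hp))]
  rw [regionGap, ← mul_re_ell hI hp, hfactor, norm_mul, norm_mul, norm_pow, RCLike.norm_ofNat]
  ring

theorem regionGap_nonneg_iff (hI : 0 < invSum Λ) (hp : p.2 ≠ 0) :
    0 ≤ regionGap σ Λ p ↔ ‖ellDeriv σ Λ p‖ ≤ 2 * (ell Λ p.2).re := by
  rw [regionGap_of_snd_ne_zero hI hp, mul_nonneg_iff_of_pos_left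
    (mul_pos two_pos (pow_pos (norm_pos_iff.2 hp) 2)), sub_nonneg]

theorem regionGap_eq_zero_iff (hI : 0 < invSum Λ) (hp : p.2 ≠ 0) :
    regionGap σ Λ p = 0 ↔ ‖ellDeriv σ Λ p‖ = 2 * (ell Λ p.2).re := by
  rw [regionGap_of_snd_ne_zero hI hp, mul_eq_zero_iff_left
    (mul_pos two_pos (pow_pos (norm_pos_iff.2 hp) 2)).ne', sub_eq_zero, eq_comm]

theorem mem_Omega_and_mem_ZDisk_iff (hI : 0 < invSum Λ) :
    (p.2 ∈ Omega Λ ∧ p.1 ∈ ZDisk σ Λ p.2) ↔ 0 ≤ regionGap σ Λ p := by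
  by_cases h0 : p.2 = 0
  · simp [regionGap_of_snd_eq_zero h0, ZDisk, h0, zero_mem_Omega hI]
  · have hZ : p.1 ∈ ZDisk σ Λ p.2 ↔ ‖ellDeriv σ Λ p‖ ≤ 2 * (ell Λ p.2).re := by
      simp [ZDisk, h0, ellDeriv, two_mul_re_ell, invSum]
    rw [regionGap_nonneg_iff hI h0, hZ, ← re_ell_nonneg_iff hI h0, and_iff_right_iff_imp]
    exact fun h => nonneg_of_mul_nonneg_right ((norm_nonneg _).trans h) two_pos

theorem exists_regionGap_add_mul (p : ℂ × ℂ) :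
    ∃ u : ℂ, ∀ t : ℝ, 0 ≤ t → regionGap σ Λ (p.1 + t * u, p.2) = regionGap σ Λ p - t := by
  set v := p.1 - 2 * p.2 ^ 2 * ∑ k, conj (σ k) / ((|Λ k| : ℝ) : ℂ) with hv
  refine ⟨Complex.exp (v.arg * Complex.I), fun t ht => ?_⟩
  have hnorm : ‖v + t * Complex.exp (v.arg * Complex.I)‖ = ‖v‖ + t := by
    nth_rw 1 [← Complex.norm_mul_exp_arg_mul_I v]
    rw [← add_mul, norm_mul, Complex.norm_exp_ofReal_mul_I, mul_one, ← Complex.ofReal_add,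
      Complex.norm_real, Real.norm_of_nonneg (by positivity)]
  rw [regionGap, regionGap, ← hv, add_sub_right_comm, ← hv, hnorm]
  ring

theorem frontier_regionGap_nonneg :
    frontier {p | 0 ≤ regionGap σ Λ p} = {p | regionGap σ Λ p = 0} := by
  refine Subset.antisymm (fun p hp =>
    (frontier_le_subset_eq continuous_const continuous_regionGap hp).symm) fun p hp => ?_
  obtain ⟨u, hu⟩ := exists_regionGap_add_mul (σ := σ) (Λ := Λ) p
  have hcont : Continuous fun t : ℝ => (p.1 + t * u, p.2) := by fun_prop
  have hlim : Tendsto (fun t : ℝ => (p.1 + t * u, p.2)) (𝓝[>] 0) (𝓝 p) :=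
    (hcont.tendsto' 0 p (by simp)).mono_left nhdsWithin_le_nhds
  rw [frontier_eq_closure_inter_closure]
  refine ⟨subset_closure (mem_ofPred_eq ▸ hp.ge), mem_closure_of_tendsto hlim ?_⟩
  filter_upwards [self_mem_nhdsWithin] with t ht
  rw [mem_compl_iff, mem_ofPred_eq, hu t (le_of_lt ht), hp, zero_sub, neg_nonneg, not_le]
  exact ht

theorem exists_norm_le_one_mul_eq {w : ℂ} {a : ℝ} (h : ‖w‖ ≤ a) :
    ∃ c : ℂ, ‖c‖ ≤ 1 ∧ (‖w‖ = a → ‖c‖ = 1) ∧ a * c = w := by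
  have ha := (norm_nonneg w).trans h
  rcases eq_or_ne a 0 with rfl | ha0
  · exact ⟨1, norm_one.le, fun _ => norm_one, by simpa [eq_comm] using h⟩
  · have hnorm : ‖w / a‖ = ‖w‖ / a := by rw [norm_div, Complex.norm_real, Real.norm_of_nonneg ha]
    refine ⟨w / a, ?_, fun hw => ?_, mul_div_cancel₀ _ (Complex.ofReal_ne_zero.2 ha0)⟩
    · rw [hnorm]
      exact div_le_one_of_le₀ h ha
    · rw [hnorm, hw, div_self ha0]

end Region

/-! ### The value region and its boundary -/

section Extremal

variable {n : ℕ} {σ : Fin n → ℂ} {Λ : Fin n → ℝ} {ω c : ℂ} {E : ℂ → ℂ}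

theorem extremalInt_eq {s : ℂ} (hs : ‖s‖ = 1) :
    extremalInt σ Λ ω s = moebiusGenerator σ Λ ω (conj s) := by
  have hs1 : s * conj s = 1 := by
    rw [Complex.mul_conj, Complex.normSq_eq_norm_sq, hs, one_pow, Complex.ofReal_one]
  funext z
  have hquot : (s + z) / (s - z) = (1 + conj s * z) / (1 - conj s * z) := by
    rw [← mul_div_mul_left (1 + conj s * z) _ (left_ne_zero_of_mul (hs1.trans_ne one_ne_zero))]
    congr 1
    · linear_combination (-z) * hs1
    · linear_combination z * hs1
  rw [extremalInt, moebiusGenerator, moebius, hquot, mul_comm ((1 + conj s * z) / _)]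

theorem extremalBdry_eq (hI : 0 < invSum Λ) (hω0 : ω ≠ 0) (hω : ω ∈ frontier (Omega Λ)) (c : ℂ) :
    extremalBdry σ Λ ω = moebiusGenerator σ Λ ω c := by
  funext z
  rw [extremalBdry, moebiusGenerator, moebius, re_ell_eq_zero_of_mem_frontier hI hω0 hω,
    Complex.ofReal_zero, zero_mul, zero_add]

theorem isExtremal_zero_iff (hI : 0 < invSum Λ) : IsExtremal σ Λ 0 E ↔ E = fun _ => 0 := by
  simp [IsExtremal, zero_notMem_interior_Omega hI]

theorem isExtremal_iff (hI : 0 < invSum Λ) (hω0 : ω ≠ 0) :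
    IsExtremal σ Λ ω E ↔ ω ∈ Omega Λ ∧ ∃ c : ℂ, ‖c‖ = 1 ∧ E = moebiusGenerator σ Λ ω c := by
  constructor
  · rintro (⟨hω, s, hs, rfl⟩ | ⟨hω, -, rfl⟩ | ⟨hω, -⟩)
    · exact ⟨interior_subset hω, conj s, (RCLike.norm_conj s).trans hs, extremalInt_eq hs⟩
    · exact ⟨isClosed_Omega.frontier_subset hω, 1, norm_one, extremalBdry_eq hI hω0 hω 1⟩
    · exact absurd hω hω0
  · rintro ⟨hω, c, hc, rfl⟩
    by_cases hinterior : ω ∈ interior (Omega Λ)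
    · have hc' := (RCLike.norm_conj c).trans hc
      exact Or.inl ⟨hinterior, conj c, hc', by rw [extremalInt_eq hc', Complex.conj_conj]⟩
    · have hfr : ω ∈ frontier (Omega Λ) := isClosed_Omega.frontier_eq ▸ ⟨hω, hinterior⟩
      exact Or.inr (Or.inl ⟨hfr, hω0, (extremalBdry_eq hI hω0 hfr c).symm⟩)

end Extremal

section ValueRegion

theorem IsGenerator.existsUnique_isSpectralValue {G : ℂ → ℂ} {φ : ℝ → ℂ → ℂ}
    (hφ : IsGenerator G φ) (hDW : SemigroupDWPoint φ 0) : ∃! l : ℂ, IsSpectralValue G 0 l := by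
  have hre := fun z (hz : z ∈ disk) => hφ.re_conj_mul_nonpos hDW hz
  exact ⟨_, (hφ.isSpectralValue_iff hre).2 rfl, fun l => (hφ.isSpectralValue_iff hre).1⟩

variable {n : ℕ} {σ : Fin n → ℂ} {Λ : Fin n → ℝ} {ω c : ℂ} {p : ℂ × ℂ} {G E : ℂ → ℂ}

variable (hn : 0 < n) (hσ : ∀ k, ‖σ k‖ = 1) (hΛ : ∀ k, Λ k < 0)

include hn hσ hΛ

theorem norm_ellDeriv_valuePair_moebiusGenerator (hω : 0 ≤ (ell Λ ω).re) (hc : ‖c‖ = 1) :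
    ‖ellDeriv σ Λ (valuePair (moebiusGenerator σ Λ ω c))‖ = 2 * (ell Λ ω).re := by
  rw [ellDeriv_valuePair_moebiusGenerator hn hσ hΛ hω hc.le, norm_mul, norm_mul, hc, mul_one,
    RCLike.norm_ofNat, Complex.norm_real, Real.norm_of_nonneg hω]

theorem exists_valuePair_moebiusGenerator_eq (h0 : p.2 ≠ 0)
    (h : ‖ellDeriv σ Λ p‖ ≤ 2 * (ell Λ p.2).re) :
    ∃ c : ℂ, ‖c‖ ≤ 1 ∧ (‖ellDeriv σ Λ p‖ = 2 * (ell Λ p.2).re → ‖c‖ = 1) ∧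
      valuePair (moebiusGenerator σ Λ p.2 c) = p := by
  have hω := nonneg_of_mul_nonneg_right ((norm_nonneg _).trans h) two_pos
  obtain ⟨c, hc, hc1, hcp⟩ := exists_norm_le_one_mul_eq h
  refine ⟨c, hc, hc1, eq_of_ellDeriv_eq (σ := σ) (Λ := Λ) h0
    (spectralValue_moebiusGenerator hn hσ hΛ hω hc) ?_⟩
  rw [ellDeriv_valuePair_moebiusGenerator hn hσ hΛ hω hc, ← hcp, Complex.ofReal_mul,
    Complex.ofReal_ofNat]

theorem exists_mem_GenExact_norm_ellDeriv_eq (hinj : Function.Injective σ)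
    (hω : 0 ≤ (ell Λ ω).re) :
    ∃ G ∈ GenExact 0 σ Λ, spectralValue G 0 = ω ∧
      ‖ellDeriv σ Λ (valuePair G)‖ = 2 * (ell Λ ω).re := by
  obtain ⟨c, hc, hcσ⟩ := exists_norm_eq_one_forall_mul_ne_one σ
  exact ⟨_, moebiusGenerator_mem_GenExact hn hσ hΛ hω hinj hc.le hcσ,
    spectralValue_moebiusGenerator hn hσ hΛ hω hc.le,
    norm_ellDeriv_valuePair_moebiusGenerator hn hσ hΛ hω hc⟩

variable (hinj : Function.Injective σ)

include hinj

theorem spectralValue_ne_zero (hG : G ∈ Gen 0 σ Λ) (hne : ¬ EqOn G 0 disk) :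
    spectralValue G 0 ≠ 0 := by
  obtain ⟨q, hq⟩ := exists_isCaratheodoryPart hn hσ hinj hG hne
  exact hq.spectralValue_ne_zero hn hσ hΛ

theorem norm_ellDeriv_valuePair_le (hG : G ∈ Gen 0 σ Λ) (hne : ¬ EqOn G 0 disk) :
    ‖ellDeriv σ Λ (valuePair G)‖ ≤ 2 * (ell Λ (spectralValue G 0)).re := by
  obtain ⟨q, hq⟩ := exists_isCaratheodoryPart hn hσ hinj hG hne
  rw [hq.ellDeriv_valuePair hn hσ hΛ, hq.ell_spectralValue hn hσ hΛ]
  exact hq.isCaratheodory.norm_deriv_zero_le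

theorem eqOn_moebiusGenerator (hG : G ∈ Gen 0 σ Λ) (hω0 : ω ≠ 0) (hω : 0 ≤ (ell Λ ω).re)
    (hc : ‖c‖ = 1) (h : valuePair G = valuePair (moebiusGenerator σ Λ ω c)) :
    EqOn G (moebiusGenerator σ Λ ω c) disk := by
  have hsnd : spectralValue G 0 = ω :=
    (congrArg Prod.snd h).trans (spectralValue_moebiusGenerator hn hσ hΛ hω hc.le)
  have hne : ¬ EqOn G 0 disk := fun hzero => by
    obtain ⟨φ, hφ, -⟩ := hG
    exact hω0 (hsnd.symm.trans (congrArg Prod.snd (hφ.valuePair_eq_zero hzero)))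
  obtain ⟨q, hq⟩ := exists_isCaratheodoryPart hn hσ hinj hG hne
  have hq0 : q 0 = ell Λ ω := by rw [← hq.ell_spectralValue hn hσ hΛ, hsnd]
  have hderiv : deriv q 0 = 2 * (q 0).re * c := by
    rw [← hq.ellDeriv_valuePair hn hσ hΛ, h, hq0,
      ellDeriv_valuePair_moebiusGenerator hn hσ hΛ hω hc.le]
  intro z hz
  rw [hq.eq_neg_div z hz, hq.isCaratheodory.eqOn_moebius hc hderiv hz, hq0, moebiusGenerator]

theorem valueRegion_eq : valueRegion σ Λ = {p | 0 ≤ regionGap σ Λ p} := by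
  have hI := invSum_pos hn hΛ
  refine Subset.antisymm ?_ fun p hp => ?_
  · rintro _ ⟨G, hG, rfl⟩
    by_cases hne : EqOn G 0 disk
    · obtain ⟨φ, hφ, -⟩ := hG
      rw [hφ.valuePair_eq_zero hne, mem_ofPred_eq, regionGap_of_snd_eq_zero rfl, Prod.fst_zero,
        norm_zero, neg_zero]
    · exact (regionGap_nonneg_iff hI (spectralValue_ne_zero hn hσ hΛ hinj hG hne)).2
        (norm_ellDeriv_valuePair_le hn hσ hΛ hinj hG hne)
  · rcases eq_or_ne p.2 0 with h0 | h0
    · rw [mem_ofPred_eq, regionGap_of_snd_eq_zero h0, neg_nonneg, norm_le_zero_iff] at hp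
      exact ⟨_, zero_mem_Gen hσ hΛ, valuePair_zero.trans (Prod.ext hp h0).symm⟩
    · have hle := (regionGap_nonneg_iff hI h0).1 hp
      have hω := nonneg_of_mul_nonneg_right ((norm_nonneg _).trans hle) two_pos
      obtain ⟨c, hc, -, hcp⟩ := exists_valuePair_moebiusGenerator_eq hn hσ hΛ h0 hle
      exact ⟨_, moebiusGenerator_mem_Gen hn hσ hΛ hω hinj hc, hcp⟩

theorem frontier_valueRegion : frontier (valueRegion σ Λ) = {p | regionGap σ Λ p = 0} := by
  rw [valueRegion_eq hn hσ hΛ hinj, frontier_regionGap_nonneg]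

theorem exists_isExtremal_of_mem_frontier (hp : p ∈ frontier (valueRegion σ Λ)) :
    ∃ E ∈ Gen 0 σ Λ, IsExtremal σ Λ p.2 E ∧ valuePair E = p ∧
      ∀ G ∈ Gen 0 σ Λ, valuePair G = p → EqOn G E disk := by
  have hI := invSum_pos hn hΛ
  rw [frontier_valueRegion hn hσ hΛ hinj, mem_ofPred_eq] at hp
  rcases eq_or_ne p.2 0 with h0 | h0
  · rw [regionGap_of_snd_eq_zero h0, neg_eq_zero, norm_eq_zero] at hp
    refine ⟨_, zero_mem_Gen hσ hΛ, by rw [h0, isExtremal_zero_iff hI],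
      valuePair_zero.trans (Prod.ext hp h0).symm, fun G hG hGp => ?_⟩
    by_contra hne
    exact spectralValue_ne_zero hn hσ hΛ hinj hG hne ((congrArg Prod.snd hGp).trans h0)
  · have heq := (regionGap_eq_zero_iff hI h0).1 hp
    have hω := nonneg_of_mul_nonneg_right ((norm_nonneg _).trans heq.le) two_pos
    obtain ⟨c, -, hc, hcp⟩ := exists_valuePair_moebiusGenerator_eq hn hσ hΛ h0 heq.le
    have hc1 := hc heq
    exact ⟨_, moebiusGenerator_mem_Gen hn hσ hΛ hω hinj hc1.le,
      (isExtremal_iff hI h0).2 ⟨(re_ell_nonneg_iff hI h0).1 hω, c, hc1, rfl⟩, hcp,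
      fun G hG hGp => eqOn_moebiusGenerator hn hσ hΛ hinj hG h0 hω hc1 (hGp.trans hcp.symm)⟩

theorem IsExtremal.mem_Gen_and_valuePair_mem_frontier (hE : IsExtremal σ Λ ω E) :
    E ∈ Gen 0 σ Λ ∧ spectralValue E 0 = ω ∧ valuePair E ∈ frontier (valueRegion σ Λ) := by
  have hI := invSum_pos hn hΛ
  rw [frontier_valueRegion hn hσ hΛ hinj, mem_ofPred_eq]
  rcases eq_or_ne ω 0 with rfl | h0
  · obtain rfl := (isExtremal_zero_iff hI).1 hE
    refine ⟨zero_mem_Gen hσ hΛ, congrArg Prod.snd valuePair_zero, ?_⟩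
    rw [valuePair_zero, regionGap_of_snd_eq_zero rfl, Prod.fst_zero, norm_zero, neg_zero]
  · obtain ⟨hmem, c, hc, rfl⟩ := (isExtremal_iff hI h0).1 hE
    have hω := (re_ell_nonneg_iff hI h0).2 hmem
    have hsnd := spectralValue_moebiusGenerator hn hσ hΛ hω hc.le
    refine ⟨moebiusGenerator_mem_Gen hn hσ hΛ hω hinj hc.le, hsnd,
      (regionGap_eq_zero_iff hI (hsnd.trans_ne h0)).2 ?_⟩
    rw [norm_ellDeriv_valuePair_moebiusGenerator hn hσ hΛ hω hc, valuePair, hsnd]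

end ValueRegion

end DiskSemigroup

open DiskSemigroup in
theorem mainTheorem3 {n : ℕ} (hn : 0 < n) (σ : Fin n → ℂ) (Λ : Fin n → ℝ)
    (hσ : ∀ k, ‖σ k‖ = 1) (hinj : Function.Injective σ) (hΛ : ∀ k, Λ k < 0) :
    -- the spectral value of each generator in the class is well defined
    (∀ G ∈ Gen 0 σ Λ, ∃! l : ℂ, IsSpectralValue G 0 l) ∧
    -- the value region
    valueRegion σ Λ = {p : ℂ × ℂ | p.2 ∈ Omega Λ ∧ p.1 ∈ ZDisk σ Λ p.2} ∧
    -- each boundary point is delivered by a unique generator, and that one is in the list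
    (∀ p ∈ frontier (valueRegion σ Λ), ∃ E ∈ Gen 0 σ Λ,
      IsExtremal σ Λ p.2 E ∧ valuePair E = p ∧
        ∀ G ∈ Gen 0 σ Λ, valuePair G = p → EqOn G E disk) ∧
    -- each function in the list belongs to the class and delivers a boundary point
    (∀ (ω : ℂ) (E : ℂ → ℂ), IsExtremal σ Λ ω E →
      E ∈ Gen 0 σ Λ ∧ spectralValue E 0 = ω ∧ valuePair E ∈ frontier (valueRegion σ Λ)) ∧
    -- the inequality
    (∀ G ∈ Gen 0 σ Λ, ¬ EqOn G 0 disk →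
      spectralValue G 0 ≠ 0 ∧
      ‖iteratedDeriv 2 G 0 / (2 * spectralValue G 0 ^ 2)
          - ∑ k, conj (σ k) / ((|Λ k| : ℝ) : ℂ)‖
        ≤ 2 * (1 / spectralValue G 0).re - ∑ k, 1 / |Λ k|) ∧
    -- its sharpness, for every nonzero spectral value and with prescribed boundary spectral values
    (∀ ω ∈ Omega Λ, ω ≠ 0 → ∃ G ∈ GenExact 0 σ Λ, spectralValue G 0 = ω ∧
      ‖iteratedDeriv 2 G 0 / (2 * ω ^ 2) - ∑ k, conj (σ k) / ((|Λ k| : ℝ) : ℂ)‖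
        = 2 * (1 / ω).re - ∑ k, 1 / |Λ k|) := by
  have hI := invSum_pos hn hΛ
  refine ⟨?_, ?_, ?_, ?_, ?_, ?_⟩
  · rintro G ⟨φ, hφ, hDW, -⟩
    exact hφ.existsUnique_isSpectralValue hDW
  · simp only [valueRegion_eq hn hσ hΛ hinj, mem_Omega_and_mem_ZDisk_iff hI]
  · exact fun p hp => exists_isExtremal_of_mem_frontier hn hσ hΛ hinj hp
  · exact fun ω E hE => hE.mem_Gen_and_valuePair_mem_frontier hn hσ hΛ hinj
  · intro G hG hne
    refine ⟨spectralValue_ne_zero hn hσ hΛ hinj hG hne, ?_⟩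
    rw [← two_mul_re_ell]
    exact norm_ellDeriv_valuePair_le hn hσ hΛ hinj hG hne
  · intro ω hω h0
    obtain ⟨G, hG, rfl, heq⟩ :=
      exists_mem_GenExact_norm_ellDeriv_eq hn hσ hΛ hinj ((re_ell_nonneg_iff hI h0).2 hω)
    exact ⟨G, hG, rfl, heq.trans (two_mul_re_ell _)⟩
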